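/- Let $n\ge 1$ and let $f:\{-1,1\}^n\to\{-1,1\}$; denote also by $f$ its multilinear (harmonic) extension $f(x)=\sum_{S\subseteq[n]}\hat f(S)\prod_{i\in S}x_i$ to $\mathbb{R}^n$. For $0<\varepsilon\le 1$, an axis-aligned jump process with jump size $\varepsilon$ started at $x\in[-1,1]^n$ is a discrete-time process $X(t)\in[-1,1]^n$ with $X(0)=x$ which evolves as follows. If $X(t)\in\{-1,1\}^n$, then $X(t+1)=X(t)$. Otherwise a direction $i_t$ with $X_{i_t}(t)\in(-1,1)$ is chosen; the choice may depend on the time, on the history, and on additional randomness independent of future jumps. Write $y=X_{i_t}(t)$ and set $(a,b)=(1-2\varepsilon,1)$ if $y+\varepsilon>1$, $(a,b)=(-1,-1+2\varepsilon)$ if $y-\varepsilon<-1$, and $(a,b)=(y-\varepsilon,y+\varepsilon)$ otherwise (if $\varepsilon\le1$, at most one of the first two cases occurs). Then, given the past, $X_{i_t}(t+1)$ equals $a$ with probability $\frac{b-y}{2\varepsilon}$ and $b$ with probability $\frac{y-a}{2\varepsilon}$, and all other coordinates stay fixed. Let $\tau=\inf\{t\ge0: f(X(t))\in\{-1,1\}\}$,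 which is almost surely finite, and let the cost of the process be $\sum_{i=1}^n\mathrm{Var}(X_i(\tau))$. Let $u_\varepsilon(x)$ be the infimum of the cost over all such processes started at $x$. For a smooth function $\varphi:\mathbb{R}^n\to\mathbb{R}$ let $\Delta_\dagger\varphi=\min_{k}\frac{\partial^2\varphi}{\partial x_k^2}$. A function $u$ is a viscosity solution of $\Delta_\dagger u=-2$ in $(-1,1)^n$ if for every smooth $\varphi:\mathbb{R}^n\to\mathbb{R}$ and every $x_0\in(-1,1)^n$: $\Delta_\dagger\varphi(x_0)\ge-2$ whenever $\varphi-u$ has a local minimum at $x_0$, and $\Delta_\dagger\varphi(x_0)\le-2$ whenever $\varphi-u$ has a local maximum at $x_0$. Then for every $x\in[-1,1]^n$ the limit $u(x)=\lim_{k\to\infty}u_{2^{-k}}(x)$ exists, $u$ is continuous on $[-1,1]^n$, and either $u\equiv0$ on $[-1,1]^n$, or $u$ is a viscosity solution of $\Delta_\dagger u=-2$ in $(-1,1)^n$. -/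

import Mathlib

open MeasureTheory ProbabilityTheory Filter Topology

namespace AxisAligned

noncomputable section

/-! ### The cube, its vertices, and the harmonic extension -/

/-- The closed cube `[-1,1]ⁿ`. -/
def cube (n : ℕ) : Set (Fin n → ℝ) := Set.univ.pi fun _ => Set.Icc (-1) 1

/-- The open cube `(-1,1)ⁿ`. -/
def openCube (n : ℕ) : Set (Fin n → ℝ) := Set.univ.pi fun _ => Set.Ioo (-1) 1

/-- The vertices `{-1,1}ⁿ` of the cube. -/
def vertices (n : ℕ) : Set (Fin n → ℝ) := Set.univ.pi fun _ => {-1, 1}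

/-- The Fourier coefficient of a Boolean function `f : {-1,1}ⁿ → {-1,1}` at `S ⊆ [n]`, that is
the mean of `f(y) ∏_{i ∈ S} yᵢ` over uniform `y`. The two-element set `{-1,1}` is `ℤˣ`. -/
def boolFourierCoeff {n : ℕ} (f : (Fin n → ℤˣ) → ℤˣ) (S : Finset (Fin n)) : ℝ :=
  (∑ y : Fin n → ℤˣ, ((f y : ℤ) : ℝ) * ∏ i ∈ S, ((y i : ℤ) : ℝ)) / 2 ^ n

/-- The harmonic (multilinear) extension of `f` to `ℝⁿ`. -/
def harmonicExt {n : ℕ} (f : (Fin n → ℤˣ) → ℤˣ) (x : Fin n → ℝ) : ℝ :=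
  ∑ S : Finset (Fin n), boolFourierCoeff f S * ∏ i ∈ S, x i

/-! ### Axis-aligned jump processes -/

/-- The lower end `a` of a jump of size `ε` of a coordinate at position `y`. -/
def lowerEnd (ε y : ℝ) : ℝ :=
  if 1 < y + ε then 1 - 2 * ε else if y - ε < -1 then -1 else y - ε

/-- The upper end `b` of a jump of size `ε` of a coordinate at position `y`. -/
def upperEnd (ε y : ℝ) : ℝ :=
  if 1 < y + ε then 1 else if y - ε < -1 then -1 + 2 * ε else y + ε

/-- `X` is an axis-aligned jump process with jump size `ε` started at `x`, and `d t` is the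
direction chosen at time `t`. The direction may depend on everything known at time `t` (the
`σ`-algebra `ℱ t`): the time, the history of the trajectory, and additional randomness
independent of the later jumps. -/
structure IsJumpProcess {n : ℕ} {Ω : Type} [mΩ : MeasurableSpace Ω] (μ : Measure Ω)
    (ℱ : Filtration ℕ mΩ) (ε : ℝ) (x : Fin n → ℝ) (X : ℕ → Ω → Fin n → ℝ)
    (d : ℕ → Ω → Fin n) : Prop where
  adapted : ∀ t, Measurable[ℱ t] (X t)
  direction_adapted : ∀ t, Measurable[ℱ t] (d t)
  start : ∀ᵐ ω ∂μ, X 0 ω = x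
  /-- At a vertex, the process stays put. -/
  stay : ∀ t, ∀ᵐ ω ∂μ, X t ω ∈ vertices n → X (t + 1) ω = X t ω
  /-- Elsewhere, the chosen coordinate lies strictly between `-1` and `1`. -/
  direction_mem : ∀ t, ∀ᵐ ω ∂μ, X t ω ∉ vertices n → X t ω (d t ω) ∈ Set.Ioo (-1 : ℝ) 1
  /-- The other coordinates do not move. -/
  fixed : ∀ t, ∀ᵐ ω ∂μ, X t ω ∉ vertices n →
    ∀ j, j ≠ d t ω → X (t + 1) ω j = X t ω j
  /-- The chosen coordinate jumps to one of the two ends. -/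
  jump : ∀ t, ∀ᵐ ω ∂μ, X t ω ∉ vertices n →
    X (t + 1) ω (d t ω) = lowerEnd ε (X t ω (d t ω)) ∨
      X (t + 1) ω (d t ω) = upperEnd ε (X t ω (d t ω))
  /-- Given what is known at time `t`, it jumps from `y` to the upper end `b` with probability
  `(y - a) / (2ε)`, where `a` is the lower end. -/
  law : ∀ t, ∀ᵐ ω ∂μ, X t ω ∉ vertices n →
    (μ⟦{ω' | X (t + 1) ω' (d t ω') = upperEnd ε (X t ω' (d t ω'))} | ℱ t⟧) ω =
      (X t ω (d t ω) - lowerEnd ε (X t ω (d t ω))) / (2 * ε)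

/-- The first time `t ≥ 0` at which `f(X(t)) ∈ {-1,1}`. -/
def stopTime {n : ℕ} (f : (Fin n → ℤˣ) → ℤˣ) {Ω : Type} (X : ℕ → Ω → Fin n → ℝ) :
    Ω → WithTop ℕ :=
  hittingAfter X {z | harmonicExt f z ∈ ({-1, 1} : Set ℝ)} 0

/-- The cost `∑ᵢ Var(Xᵢ(τ))` of the zero-error algorithm which runs `X` until the time `τ`. -/
def cost {n : ℕ} (f : (Fin n → ℤˣ) → ℤˣ) {Ω : Type} [MeasurableSpace Ω] (μ : Measure Ω)
    (X : ℕ → Ω → Fin n → ℝ) : ℝ :=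
  ∑ i, Var[fun ω => stoppedValue X (stopTime f X) ω i; μ]

/-- The costs of all axis-aligned algorithms for `f` with jump size `ε` started at `x`. -/
def costSet {n : ℕ} (f : (Fin n → ℤˣ) → ℤˣ) (ε : ℝ) (x : Fin n → ℝ) : Set ℝ :=
  {c | ∃ (Ω : Type) (mΩ : MeasurableSpace Ω) (μ : Measure Ω) (_ : IsProbabilityMeasure μ)
    (ℱ : Filtration ℕ mΩ) (X : ℕ → Ω → Fin n → ℝ) (d : ℕ → Ω → Fin n),
    IsJumpProcess μ ℱ ε x X d ∧ c = cost f μ X}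

/-- The best cost `u_ε(x)` over all axis-aligned algorithms. -/
def bestCost {n : ℕ} (f : (Fin n → ℤˣ) → ℤˣ) (ε : ℝ) (x : Fin n → ℝ) : ℝ :=
  sInf (costSet f ε x)

/-- The limiting cost `u(x)`, the limit of `u_ε(x)` as `ε = 2⁻ᵏ → 0`. -/
def limitCost {n : ℕ} (f : (Fin n → ℤˣ) → ℤˣ) (x : Fin n → ℝ) : ℝ :=
  limUnder atTop fun k : ℕ => bestCost f ((1 / 2 : ℝ) ^ k) x

/-! ### The axis-aligned Laplacian and viscosity solutions -/

/-- The second partial derivative `∂²φ/∂xₖ²` at `x`. -/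
def secondPartial {n : ℕ} (φ : (Fin n → ℝ) → ℝ) (k : Fin n) (x : Fin n → ℝ) : ℝ :=
  iteratedDeriv 2 (fun s : ℝ => φ (x + s • Pi.single k 1)) 0

/-- The axis-aligned Laplacian `min_k ∂²φ/∂xₖ²`. -/
def axisLaplacian {n : ℕ} (φ : (Fin n → ℝ) → ℝ) (x : Fin n → ℝ) : ℝ :=
  ⨅ k : Fin n, secondPartial φ k x

/-- `u` is a viscosity subsolution of `Δ† u = g` in the open set `U`. -/
def IsViscositySubsolution {n : ℕ} (U : Set (Fin n → ℝ)) (u g : (Fin n → ℝ) → ℝ) : Prop :=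
  ∀ φ : (Fin n → ℝ) → ℝ, ContDiff ℝ ((⊤ : ℕ∞) : WithTop ℕ∞) φ → ∀ x₀ ∈ U,
    IsLocalMin (fun x => φ x - u x) x₀ → g x₀ ≤ axisLaplacian φ x₀

/-- `u` is a viscosity supersolution of `Δ† u = g` in the open set `U`. -/
def IsViscositySupersolution {n : ℕ} (U : Set (Fin n → ℝ)) (u g : (Fin n → ℝ) → ℝ) : Prop :=
  ∀ φ : (Fin n → ℝ) → ℝ, ContDiff ℝ ((⊤ : ℕ∞) : WithTop ℕ∞) φ → ∀ x₀ ∈ U,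
    IsLocalMax (fun x => φ x - u x) x₀ → axisLaplacian φ x₀ ≤ g x₀

/-- `u` is a viscosity solution of `Δ† u = g` in the open set `U`. -/
def IsViscositySolution {n : ℕ} (U : Set (Fin n → ℝ)) (u g : (Fin n → ℝ) → ℝ) : Prop :=
  IsViscositySubsolution U u g ∧ IsViscositySupersolution U u g

end

end AxisAligned

/-! ### The cube and the harmonic extension. -/

namespace AxisAligned

noncomputable section

variable {n : ℕ}

/-! ### The cube -/

/-! Call a point solved if the harmonic extension is `±1` there. Each coordinate of a jump process
is a martingale, so the cost equals `E|X(τ)|² - |x|²` (`IsJumpProcess.cost_eq`), and the task is to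
choose directions minimizing `E|X(τ)|²`. The value function is `W_ε`, the largest function lying
below its mean after every jump and below `|·|²` on the solved points. Optional stopping shows that
no process beats it. Being largest, `W_ε` equals its mean in some direction at every unsolved point
(`exists_jumpMean_le`), and the walk following these directions attains it; hence `u_ε = W_ε - |x|²`
(`bestCost_eq`). Stopping is almost sure because every step before it raises the mean of the bounded
quantity `|X|²` by a definite amount.

Let `W` be the largest separately convex function on the cube below `|·|²` on the solved points.
Jumps follow chords, so `W ≤ W_ε`. Conversely, the upper half-relaxed limit of `W_ε` is separately
convex and below `|·|²` on the solved points (`isMinorant_relaxedLimit`), so it is at most `W`. Thus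
`u = W - |x|²` (`tendsto_envelope_jump`). A comparison function that is affine in one coordinate
bounds the slope of `W` at each face (`envelope_update_le`), and convexity spreads this bound to a
Lipschitz bound on the cube.

Separate convexity of `W` says that `u` has second derivatives at least `-2` in the viscosity sense,
which is the subsolution property. Maximality gives the other half: if a test function touching `u`
from below had all second partials above `-2`, then adding `|·|²`, bending it down slightly, raising
it and taking the maximum with `W` would give a larger admissible function (`isMinorant_max`). This
needs the open cube to be free of solved points. If it is not, the extension, being affine in each
coordinate and bounded by `1`, makes the whole cube solved, and `u = 0`. -/

lemma mem_cube {x : Fin n → ℝ} : x ∈ cube n ↔ ∀ i, x i ∈ Set.Icc (-1 : ℝ) 1 := by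
  simp only [cube, Set.mem_univ_pi]

lemma mem_openCube {x : Fin n → ℝ} : x ∈ openCube n ↔ ∀ i, x i ∈ Set.Ioo (-1 : ℝ) 1 := by
  simp only [openCube, Set.mem_univ_pi]

lemma mem_vertices {x : Fin n → ℝ} : x ∈ vertices n ↔ ∀ i, x i = -1 ∨ x i = 1 := by
  simp [vertices]

lemma openCube_subset_cube : openCube n ⊆ cube n := fun _ hx =>
  mem_cube.2 fun i => Set.Ioo_subset_Icc_self (mem_openCube.1 hx i)

lemma isOpen_openCube : IsOpen (openCube n) :=
  isOpen_set_pi Set.finite_univ fun _ _ => isOpen_Ioo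

lemma update_mem_cube {x : Fin n → ℝ} (hx : x ∈ cube n) (i : Fin n) {t : ℝ}
    (ht : t ∈ Set.Icc (-1 : ℝ) 1) : Function.update x i t ∈ cube n := by
  rw [mem_cube] at hx ⊢
  intro j
  rcases eq_or_ne j i with rfl | hj
  · simpa using ht
  · simpa [hj] using hx j

lemma piecewise_mem_cube {x y : Fin n → ℝ} (hx : x ∈ cube n) (hy : y ∈ cube n)
    (S : Finset (Fin n)) : S.piecewise y x ∈ cube n := by
  rw [mem_cube] at hx hy ⊢
  intro j
  by_cases hj : j ∈ S
  · simpa [hj] using hy j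
  · simpa [hj] using hx j

lemma mem_Ioo_of_ne {t : ℝ} (ht : t ∈ Set.Icc (-1 : ℝ) 1) (h1 : t ≠ -1) (h2 : t ≠ 1) :
    t ∈ Set.Ioo (-1 : ℝ) 1 :=
  ⟨lt_of_le_of_ne ht.1 (Ne.symm h1), lt_of_le_of_ne ht.2 h2⟩

/-- The squared Euclidean norm. -/
def sqSum (x : Fin n → ℝ) : ℝ := ∑ i, x i ^ 2

lemma sqSum_nonneg (x : Fin n → ℝ) : 0 ≤ sqSum x := Finset.sum_nonneg fun _ _ => sq_nonneg _

lemma sqSum_le {x : Fin n → ℝ} (hx : x ∈ cube n) : sqSum x ≤ n := by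
  have h : ∀ i ∈ Finset.univ, x i ^ 2 ≤ (1 : ℝ) := fun i _ => by
    have := mem_cube.1 hx i
    nlinarith [this.1, this.2]
  simpa [sqSum] using Finset.sum_le_sum h

lemma sqSum_update (x : Fin n → ℝ) (i : Fin n) (t : ℝ) :
    sqSum (Function.update x i t) = sqSum x - x i ^ 2 + t ^ 2 := by
  unfold sqSum
  rw [← Finset.add_sum_erase _ _ (Finset.mem_univ i),
    ← Finset.add_sum_erase _ (fun j => x j ^ 2) (Finset.mem_univ i),
    Finset.sum_congr rfl (g := fun j => x j ^ 2)]
  · simp; ring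
  · intro j hj
    simp [Finset.ne_of_mem_erase hj]

lemma continuous_sqSum : Continuous (sqSum : (Fin n → ℝ) → ℝ) := by
  unfold sqSum; fun_prop

/-- Changing coordinates one at a time: a one-coordinate bound gives a bound for many. -/
lemma le_piecewise_add_sum {F : (Fin n → ℝ) → ℝ} {C : ℝ} {y : Fin n → ℝ} (hy : y ∈ cube n)
    (S : Finset (Fin n))
    (hF : ∀ x ∈ cube n, ∀ i ∈ S, F x ≤ F (Function.update x i (y i)) + C * |x i - y i|)
    {x : Fin n → ℝ} (hx : x ∈ cube n) :
    F x ≤ F (S.piecewise y x) + C * ∑ i ∈ S, |x i - y i| := by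
  induction S using Finset.induction_on with
  | empty => simp
  | insert a S ha ih =>
    have h1 := ih fun x hx i hi => hF x hx i (Finset.mem_insert_of_mem hi)
    have h2 := hF (S.piecewise y x) (piecewise_mem_cube hx hy S) a (Finset.mem_insert_self a S)
    rw [Finset.piecewise_eq_of_notMem _ _ _ ha] at h2
    rw [Finset.piecewise_insert, Finset.sum_insert ha]
    linarith

/-! ### The harmonic extension -/

/-- The weight of the vertex `y` in the harmonic extension at `x`. -/
def vertexWeight (x : Fin n → ℝ) (y : Fin n → ℤˣ) : ℝ := ∏ i, (1 + x i * ((y i : ℤ) : ℝ)) / 2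

/-- Expanding `∏ (1 + xᵢ yᵢ)` over subsets gives the Fourier sum. For `x` in the cube the weights
are the product law on vertices with mean `x`, so the extension is an average of values of `f`. -/
lemma harmonicExt_eq_sum (f : (Fin n → ℤˣ) → ℤˣ) (x : Fin n → ℝ) :
    harmonicExt f x = ∑ y, ((f y : ℤ) : ℝ) * vertexWeight x y := by
  have hw : ∀ y : Fin n → ℤˣ, vertexWeight x y =
      (∑ S : Finset (Fin n), ∏ i ∈ S, x i * ((y i : ℤ) : ℝ)) / 2 ^ n := by
    intro y
    rw [vertexWeight, Finset.prod_div_distrib, Finset.prod_one_add]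
    simp
  simp only [harmonicExt, boolFourierCoeff, hw, Finset.sum_div, Finset.sum_mul, Finset.mul_sum,
    Finset.prod_mul_distrib]
  rw [Finset.sum_comm]
  refine Finset.sum_congr rfl fun y _ => Finset.sum_congr rfl fun S _ => ?_
  ring

lemma sum_vertexWeight (x : Fin n → ℝ) : ∑ y, vertexWeight x y = 1 := by
  have h := (Finset.prod_univ_sum (fun _ : Fin n => (Finset.univ : Finset ℤˣ))
    (fun i u => (1 + x i * ((u : ℤ) : ℝ)) / 2)).symm
  rw [Fintype.piFinset_univ] at h
  unfold vertexWeight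
  rw [h]
  refine Finset.prod_eq_one fun i _ => ?_
  rw [show (Finset.univ : Finset ℤˣ) = {1, -1} by decide, Finset.sum_pair (by decide)]
  push_cast
  ring

lemma intUnit_cast (u : ℤˣ) : ((u : ℤ) : ℝ) = 1 ∨ ((u : ℤ) : ℝ) = -1 := by
  rcases Int.units_eq_one_or u with h | h <;> simp [h]

lemma vertexWeight_nonneg {x : Fin n → ℝ} (hx : x ∈ cube n) (y : Fin n → ℤˣ) :
    0 ≤ vertexWeight x y := by
  refine Finset.prod_nonneg fun i _ => ?_
  have := mem_cube.1 hx i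
  rcases intUnit_cast (y i) with h | h <;> rw [h] <;> linarith [this.1, this.2]

lemma abs_harmonicExt_le (f : (Fin n → ℤˣ) → ℤˣ) {x : Fin n → ℝ} (hx : x ∈ cube n) :
    |harmonicExt f x| ≤ 1 := by
  rw [harmonicExt_eq_sum]
  refine (Finset.abs_sum_le_sum_abs _ _).trans ?_
  rw [← sum_vertexWeight x]
  refine Finset.sum_le_sum fun y _ => ?_
  rw [abs_mul, abs_of_nonneg (vertexWeight_nonneg hx y)]
  rcases intUnit_cast (f y) with h | h <;> simp [h]

lemma continuous_harmonicExt (f : (Fin n → ℤˣ) → ℤˣ) : Continuous (harmonicExt f) := by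
  unfold harmonicExt; fun_prop

/-- The harmonic extension is affine in each coordinate. -/
lemma harmonicExt_update (f : (Fin n → ℤˣ) → ℤˣ) (x : Fin n → ℝ) (i : Fin n) :
    ∃ p q : ℝ, ∀ t, harmonicExt f (Function.update x i t) = p + q * t := by
  have key : ∀ S : Finset (Fin n), ∃ p q : ℝ, ∀ t,
      boolFourierCoeff f S * ∏ j ∈ S, Function.update x i t j = p + q * t := by
    intro S
    by_cases hi : i ∈ S
    · refine ⟨0, boolFourierCoeff f S * ∏ j ∈ S \ {i}, x j, fun t => ?_⟩
      rw [Finset.prod_update_of_mem hi]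
      ring
    · refine ⟨boolFourierCoeff f S * ∏ j ∈ S, x j, 0, fun t => ?_⟩
      rw [Finset.prod_update_of_notMem hi]
      ring
  choose p q hpq using key
  refine ⟨∑ S, p S, ∑ S, q S, fun t => ?_⟩
  simp only [harmonicExt, hpq, Finset.sum_add_distrib, Finset.sum_mul]

/-- The set where the harmonic extension takes one of the values `-1` and `1`. -/
def solved (f : (Fin n → ℤˣ) → ℤˣ) : Set (Fin n → ℝ) := {z | harmonicExt f z ∈ ({-1, 1} : Set ℝ)}

lemma mem_solved {f : (Fin n → ℤˣ) → ℤˣ} {z : Fin n → ℝ} :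
    z ∈ solved f ↔ harmonicExt f z = -1 ∨ harmonicExt f z = 1 := by
  simp [solved]

lemma measurableSet_solved (f : (Fin n → ℤˣ) → ℤˣ) : MeasurableSet (solved f) :=
  (continuous_harmonicExt f).measurable (Set.toFinite _).measurableSet

/-- If `x` is solved and its `i`-th coordinate is interior, the whole line through `x` in
direction `i` is solved. -/
lemma update_mem_solved {f : (Fin n → ℤˣ) → ℤˣ} {x : Fin n → ℝ} (hx : x ∈ cube n)
    (hf : x ∈ solved f) {i : Fin n} (hi : x i ∈ Set.Ioo (-1 : ℝ) 1) (t : ℝ) :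
    Function.update x i t ∈ solved f := by
  obtain ⟨p, q, h⟩ := harmonicExt_update f x i
  have h0 := h (x i)
  rw [Function.update_eq_self] at h0
  have h1 := abs_le.1 (h 1 ▸ abs_harmonicExt_le f (update_mem_cube hx i (t := 1) (by simp)))
  have h2 := abs_le.1 (h (-1) ▸ abs_harmonicExt_le f (update_mem_cube hx i (t := -1) (by simp)))
  -- An affine function on `[-1,1]` with values in `[-1,1]` that is extremal at an interior point
  -- has slope zero.
  have hq : q = 0 := by
    rcases mem_solved.1 hf with h3 | h3
    · rw [h0] at h3
      have e1 : 0 ≤ q * (1 - x i) := by linarith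
      have e2 : 0 ≤ -q * (1 + x i) := by linarith
      have := nonneg_of_mul_nonneg_left e1 (by linarith [hi.2])
      have := nonneg_of_mul_nonneg_left e2 (by linarith [hi.1])
      linarith
    · rw [h0] at h3
      have e1 : 0 ≤ -q * (1 - x i) := by linarith
      have e2 : 0 ≤ q * (1 + x i) := by linarith
      have := nonneg_of_mul_nonneg_left e1 (by linarith [hi.2])
      have := nonneg_of_mul_nonneg_left e2 (by linarith [hi.1])
      linarith
  rw [mem_solved] at hf ⊢
  rw [h t, hq]
  rw [h0, hq] at hf
  simpa using hf

/-- Replacing interior coordinates of a solved point keeps it solved. -/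
lemma piecewise_mem_solved {f : (Fin n → ℤˣ) → ℤˣ} {x y : Fin n → ℝ} (hx : x ∈ cube n)
    (hy : y ∈ cube n) (hf : x ∈ solved f) (S : Finset (Fin n))
    (hS : ∀ i ∈ S, x i ∈ Set.Ioo (-1 : ℝ) 1) : S.piecewise y x ∈ solved f := by
  induction S using Finset.induction_on with
  | empty => simpa using hf
  | insert a S ha ih =>
    rw [Finset.piecewise_insert]
    refine update_mem_solved (piecewise_mem_cube hx hy S)
      (ih fun i hi => hS i (Finset.mem_insert_of_mem hi)) ?_ _
    rw [Finset.piecewise_eq_of_notMem _ _ _ ha]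
    exact hS a (Finset.mem_insert_self a S)

/-- At a vertex all the weight sits on that vertex. Hence a process that has not been stopped is
never at a vertex, and its jump laws apply. -/
lemma vertices_subset_solved (f : (Fin n → ℤˣ) → ℤˣ) : vertices n ⊆ solved f := by
  intro x hx
  rw [mem_vertices] at hx
  let v : Fin n → ℤˣ := fun i => if x i = 1 then 1 else -1
  have hv : ∀ i, x i = ((v i : ℤ) : ℝ) := by
    intro i
    rcases hx i with h | h
    · simp [v, h]; norm_num
    · simp [v, h]
  have hw : ∀ y, y ≠ v → vertexWeight x y = 0 := by
    intro y hy
    obtain ⟨i, hi⟩ := Function.ne_iff.1 hy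
    refine Finset.prod_eq_zero (Finset.mem_univ i) ?_
    rw [hv]
    rcases Int.units_eq_one_or (y i) with h | h <;>
      rcases Int.units_eq_one_or (v i) with h' | h' <;> simp_all
  have h1 : vertexWeight x v = 1 := by
    rw [← sum_vertexWeight x, Finset.sum_eq_single v (fun y _ => hw y) (by simp)]
  rw [mem_solved, harmonicExt_eq_sum, Finset.sum_eq_single v
    (fun y _ hy => by rw [hw y hy, mul_zero]) (by simp), h1, mul_one]
  exact (intUnit_cast (f v)).symm

end

end AxisAligned

/-! ### Chord convexity and largest minorants. -/

namespace AxisAligned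

noncomputable section

variable {n : ℕ}

/-! ### Chords and the maximum principle on a line -/

/-- On a compact set `T ⊆ [α, β]`, a continuous function which at every point of `T ∩ (α, β)`
lies below some chord with ends in `T` lies below the chord from `α` to `β`. -/
lemma le_chord_of_local {T : Set ℝ} (hT : IsCompact T) {α β : ℝ} (hTs : T ⊆ Set.Icc α β)
    {h : ℝ → ℝ} (hc : ContinuousOn h T)
    (hloc : ∀ y ∈ T, α < y → y < β → ∃ a ∈ T, ∃ b ∈ T, a < y ∧ y < b ∧
      (b - a) * h y ≤ (b - y) * h a + (y - a) * h b)
    {y : ℝ} (hy : y ∈ T) : (β - α) * h y ≤ (β - y) * h α + (y - α) * h β := by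
  set k : ℝ → ℝ := fun t => (β - α) * h t - ((β - t) * h α + (t - α) * h β) with hk
  suffices k y ≤ 0 by simp only [hk] at this; linarith
  have hkc : ContinuousOn k T := by fun_prop
  obtain ⟨m, hmT, hm⟩ := hT.exists_isMaxOn ⟨y, hy⟩ hkc
  have hA : IsCompact (T ∩ k ⁻¹' {k m}) := by
    obtain ⟨u, hu, hu'⟩ := continuousOn_iff_isClosed.1 hkc {k m} isClosed_singleton
    rw [Set.inter_comm, hu', Set.inter_comm]
    exact hT.inter_right hu
  -- The rightmost maximizer of the excess `k` over the chord. Were it interior, the right end of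
  -- its local chord would have strictly smaller `k`, which the local chord inequality forbids.
  obtain ⟨z, hz⟩ := hA.exists_isGreatest ⟨m, hmT, rfl⟩
  have hzT : z ∈ T := hz.1.1
  have hzm : k z = k m := hz.1.2
  have hαβ : α ≤ β := (hTs hy).1.trans (hTs hy).2
  have hym : k y ≤ k m := hm hy
  refine hym.trans ?_
  rw [← hzm]
  rcases eq_or_lt_of_le (hTs hzT).1 with h1 | h1
  · rw [← h1]; simp only [hk]; linarith
  rcases eq_or_lt_of_le (hTs hzT).2 with h2 | h2
  · rw [h2]; simp only [hk]; linarith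
  exfalso
  obtain ⟨a, ha, b, hb, haz, hzb, hch⟩ := hloc z hzT h1 h2
  have hka : k a ≤ k z := hzm ▸ hm ha
  have hkb : k b < k z := by
    refine lt_of_le_of_ne (hzm ▸ hm hb) fun hne => ?_
    exact absurd (hz.2 ⟨hb, hne.trans hzm⟩) (not_le.2 hzb)
  have hkch : (b - a) * k z ≤ (b - z) * k a + (z - a) * k b := by
    have := mul_le_mul_of_nonneg_left hch (by linarith : 0 ≤ β - α)
    simp only [hk]
    linarith
  nlinarith [mul_le_mul_of_nonneg_left hka (by linarith : 0 ≤ b - z),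
    mul_lt_mul_of_pos_left hkb (by linarith : 0 < z - a)]

/-- The value of `g` at `x` lies below the chord of `g` in direction `i` from `xᵢ = a` to
`xᵢ = b`. -/
def BelowChord (g : (Fin n → ℝ) → ℝ) (x : Fin n → ℝ) (i : Fin n) (a b : ℝ) : Prop :=
  (b - a) * g x ≤
    (b - x i) * g (Function.update x i a) + (x i - a) * g (Function.update x i b)

/-- `g` lies below all its axis-aligned chords in the cube which are permitted by `𝒞`. -/
def IsChordConvex (𝒞 : ℝ → ℝ → ℝ → Prop) (g : (Fin n → ℝ) → ℝ) : Prop :=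
  ∀ x ∈ cube n, ∀ i a b, 𝒞 (x i) a b → BelowChord g x i a b

/-- All chords in `[-1,1]`; the associated convexity is separate convexity on the cube. -/
def fullChord (y a b : ℝ) : Prop := -1 ≤ a ∧ a ≤ y ∧ y ≤ b ∧ b ≤ 1

/-- The chords which a jump of size `ε` follows. -/
def jumpChord (ε y a b : ℝ) : Prop :=
  y ∈ Set.Ioo (-1 : ℝ) 1 ∧ a = lowerEnd ε y ∧ b = upperEnd ε y

lemma upperEnd_sub_lowerEnd (ε y : ℝ) : upperEnd ε y - lowerEnd ε y = 2 * ε := by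
  unfold upperEnd lowerEnd; split_ifs <;> ring

lemma lowerEnd_lt {ε y : ℝ} (hε : 0 < ε) (hy : y ∈ Set.Ioo (-1 : ℝ) 1) : lowerEnd ε y < y := by
  unfold lowerEnd; split_ifs <;> linarith [hy.1]

lemma lt_upperEnd {ε y : ℝ} (hε : 0 < ε) (hy : y ∈ Set.Ioo (-1 : ℝ) 1) : y < upperEnd ε y := by
  unfold upperEnd; split_ifs <;> linarith [hy.2]

lemma neg_one_le_lowerEnd {ε y : ℝ} (h1 : ε ≤ 1) : -1 ≤ lowerEnd ε y := by
  unfold lowerEnd; split_ifs <;> linarith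

lemma upperEnd_le_one {ε y : ℝ} (h1 : ε ≤ 1) : upperEnd ε y ≤ 1 := by
  unfold upperEnd; split_ifs <;> linarith

lemma fullChord_of_jumpChord {ε : ℝ} (hε : 0 < ε) (h1 : ε ≤ 1) {y a b : ℝ}
    (h : jumpChord ε y a b) : fullChord y a b := by
  obtain ⟨hy, rfl, rfl⟩ := h
  exact ⟨neg_one_le_lowerEnd h1, (lowerEnd_lt hε hy).le, (lt_upperEnd hε hy).le,
    upperEnd_le_one h1⟩

/-- A finite set of positions which contains `-1`, `1` and `y` and is closed under jumps. -/
def grid (ε y : ℝ) : Set ℝ :=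
  {z | z ∈ Set.Icc (-1 : ℝ) 1 ∧ ∃ k : ℤ, z = y + k * ε ∨ z = 1 + k * ε ∨ z = -1 + k * ε}

lemma finite_lattice {ε : ℝ} (hε : 0 < ε) (c : ℝ) :
    {z : ℝ | z ∈ Set.Icc (-1 : ℝ) 1 ∧ ∃ k : ℤ, z = c + k * ε}.Finite := by
  refine ((Set.finite_Icc ⌊(-1 - c) / ε⌋ ⌈(1 - c) / ε⌉).image fun k : ℤ => c + k * ε).subset ?_
  rintro z ⟨hz, k, rfl⟩
  refine ⟨k, ⟨?_, ?_⟩, rfl⟩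
  · have : (-1 - c) / ε ≤ k := by rw [div_le_iff₀ hε]; linarith [hz.1]
    exact_mod_cast (Int.floor_le _).trans this
  · have : (k : ℝ) ≤ (1 - c) / ε := by rw [le_div_iff₀ hε]; linarith [hz.2]
    exact_mod_cast this.trans (Int.le_ceil _)

lemma finite_grid {ε : ℝ} (hε : 0 < ε) (y : ℝ) : (grid ε y).Finite := by
  refine ((finite_lattice hε y).union ((finite_lattice hε 1).union
    (finite_lattice hε (-1)))).subset ?_
  rintro z ⟨hz, k, h | h | h⟩
  · exact Or.inl ⟨hz, k, h⟩
  · exact Or.inr (Or.inl ⟨hz, k, h⟩)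
  · exact Or.inr (Or.inr ⟨hz, k, h⟩)

lemma self_mem_grid {ε y : ℝ} (hy : y ∈ Set.Icc (-1 : ℝ) 1) : y ∈ grid ε y :=
  ⟨hy, 0, by simp⟩

/-- A clipped jump lands on `-1` or `1 - 2ε`, off the lattice of `y` in general; this is why the
grid also contains the lattices anchored at `1` and `-1`. -/
lemma lowerEnd_mem_grid {ε y z : ℝ} (hε : 0 < ε) (h1 : ε ≤ 1) (hz : z ∈ grid ε y)
    (hz' : z ∈ Set.Ioo (-1 : ℝ) 1) : lowerEnd ε z ∈ grid ε y := by
  refine ⟨⟨neg_one_le_lowerEnd h1, ((lowerEnd_lt hε hz').trans hz'.2).le⟩, ?_⟩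
  obtain ⟨-, k, hk⟩ := hz
  unfold lowerEnd
  split_ifs
  · exact ⟨-2, by right; left; push_cast; ring⟩
  · exact ⟨0, by right; right; push_cast; ring⟩
  · refine ⟨k - 1, hk.imp ?_ (Or.imp ?_ ?_)⟩ <;> rintro rfl <;> push_cast <;> ring

lemma upperEnd_mem_grid {ε y z : ℝ} (hε : 0 < ε) (h1 : ε ≤ 1) (hz : z ∈ grid ε y)
    (hz' : z ∈ Set.Ioo (-1 : ℝ) 1) : upperEnd ε z ∈ grid ε y := by
  refine ⟨⟨(hz'.1.trans (lt_upperEnd hε hz')).le, upperEnd_le_one h1⟩, ?_⟩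
  obtain ⟨-, k, hk⟩ := hz
  unfold upperEnd
  split_ifs
  · exact ⟨0, by right; left; push_cast; ring⟩
  · exact ⟨2, by right; right; push_cast; ring⟩
  · refine ⟨k + 1, hk.imp ?_ (Or.imp ?_ ?_)⟩ <;> rintro rfl <;> push_cast <;> ring

/-- A function below the jump chords is below any chord with ends `α`, `β` on a finite set of
positions in `[α, β]` which is closed under jumps from its points in `(α, β)`. -/
lemma belowChord_of_finite {ε : ℝ} (hε : 0 < ε) {g : (Fin n → ℝ) → ℝ}
    (hg : IsChordConvex (jumpChord ε) g) {x : Fin n → ℝ} (hx : x ∈ cube n) (i : Fin n) {α β : ℝ}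
    (hα : -1 ≤ α) (hβ : β ≤ 1) {T : Set ℝ} (hT : T.Finite) (hTs : T ⊆ Set.Icc α β)
    (hcl : ∀ y ∈ T, α < y → y < β → lowerEnd ε y ∈ T ∧ upperEnd ε y ∈ T) (hxT : x i ∈ T) :
    BelowChord g x i α β := by
  have key := le_chord_of_local hT.isCompact hTs (h := fun t => g (Function.update x i t))
    (hT.continuousOn _) ?_ hxT
  · simpa [BelowChord] using key
  intro y hy h1 h2
  have hy' : y ∈ Set.Ioo (-1 : ℝ) 1 := ⟨by linarith, by linarith⟩
  obtain ⟨ha, hb⟩ := hcl y hy h1 h2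
  refine ⟨_, ha, _, hb, lowerEnd_lt hε hy', lt_upperEnd hε hy', ?_⟩
  have := hg _ (update_mem_cube hx i (t := y) ⟨hy'.1.le, hy'.2.le⟩) i (lowerEnd ε y)
    (upperEnd ε y) ⟨by simpa using hy', by simp, by simp⟩
  simpa [BelowChord] using this

/-- Walking in steps of size `ε` up to `-1` and `1`. -/
lemma belowChord_univ_of_jump {ε : ℝ} (hε : 0 < ε) (h1 : ε ≤ 1) {g : (Fin n → ℝ) → ℝ}
    (hg : IsChordConvex (jumpChord ε) g) {x : Fin n → ℝ} (hx : x ∈ cube n) (i : Fin n) :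
    BelowChord g x i (-1) 1 :=
  belowChord_of_finite hε hg hx i le_rfl le_rfl (finite_grid hε (x i)) (fun _ hz => hz.1)
    (fun _ hy ha hb => ⟨lowerEnd_mem_grid hε h1 hy ⟨ha, hb⟩, upperEnd_mem_grid hε h1 hy ⟨ha, hb⟩⟩)
    (self_mem_grid (mem_cube.1 hx i))

/-- Walking `l` steps of size `ε` down or `r` steps up. -/
lemma belowChord_steps {ε : ℝ} (hε : 0 < ε) {g : (Fin n → ℝ) → ℝ}
    (hg : IsChordConvex (jumpChord ε) g) {x : Fin n → ℝ} (hx : x ∈ cube n) (i : Fin n)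
    (l r : ℕ) (hl : -1 ≤ x i - l * ε) (hr : x i + r * ε ≤ 1) :
    BelowChord g x i (x i - l * ε) (x i + r * ε) := by
  have hpos : ∀ {k m : ℤ}, (k : ℝ) * ε < m * ε → k + 1 ≤ m := fun h => by
    exact_mod_cast lt_of_mul_lt_mul_right h hε.le
  refine belowChord_of_finite hε hg hx i hl hr
    (T := (fun k : ℤ => x i + k * ε) '' Set.Icc (-l : ℤ) r) ((Set.finite_Icc _ _).image _) ?_ ?_
    ⟨0, by simp, by simp⟩
  · rintro _ ⟨k, ⟨h1, h2⟩, rfl⟩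
    have h1' : -(l : ℝ) ≤ k := by exact_mod_cast h1
    have h2' : (k : ℝ) ≤ r := by exact_mod_cast h2
    constructor
    · simp only; nlinarith
    · simp only; nlinarith
  · rintro _ ⟨k, -, rfl⟩ ha hb
    have h1 : (-l : ℤ) + 1 ≤ k := hpos (by push_cast; simp only at ha; linarith)
    have h2 : k + 1 ≤ (r : ℤ) := hpos (by push_cast; simp only at hb; linarith)
    have h1' : -(l : ℝ) + 1 ≤ k := by exact_mod_cast h1
    have h2' : (k : ℝ) + 1 ≤ r := by exact_mod_cast h2
    -- Strictly between the ends of the walk no jump is clipped, since the next lattice points still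
    -- lie in `[-1,1]`.
    have e1 : ¬ 1 < x i + k * ε + ε := by nlinarith
    have e2 : ¬ x i + k * ε - ε < -1 := by nlinarith
    simp only [lowerEnd, upperEnd, if_neg e1, if_neg e2]
    exact ⟨⟨k - 1, ⟨by omega, by omega⟩, by push_cast; ring⟩,
      ⟨k + 1, ⟨by omega, by omega⟩, by push_cast; ring⟩⟩

/-! ### Envelopes -/

/-- `g` is chord-convex and lies below the squared norm on the solved points. -/
def IsMinorant (𝒞 : ℝ → ℝ → ℝ → Prop) (f : (Fin n → ℤˣ) → ℤˣ) (g : (Fin n → ℝ) → ℝ) : Prop :=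
  IsChordConvex 𝒞 g ∧ ∀ z ∈ cube n, z ∈ solved f → g z ≤ sqSum z

/-- The largest chord-convex function which lies below the squared norm on the solved points. -/
def envelope (𝒞 : ℝ → ℝ → ℝ → Prop) (f : (Fin n → ℤˣ) → ℤˣ) (x : Fin n → ℝ) : ℝ :=
  sSup {c | ∃ g, IsMinorant 𝒞 f g ∧ g x = c}

/-- The chords of `𝒞` lie in `[-1,1]`, and they suffice for the chords from `-1` to `1`. -/
structure IsChordSystem (n : ℕ) (𝒞 : ℝ → ℝ → ℝ → Prop) : Prop where
  full : ∀ {y a b}, 𝒞 y a b → fullChord y a b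
  belowChord : ∀ {g : (Fin n → ℝ) → ℝ}, IsChordConvex 𝒞 g → ∀ x ∈ cube n, ∀ i,
    BelowChord g x i (-1) 1

lemma isChordSystem_fullChord : IsChordSystem n fullChord where
  full := id
  belowChord hg x hx i :=
    hg x hx i _ _ ⟨le_rfl, (mem_cube.1 hx i).1, (mem_cube.1 hx i).2, le_rfl⟩

lemma isChordSystem_jumpChord {ε : ℝ} (hε : 0 < ε) (h1 : ε ≤ 1) :
    IsChordSystem n (jumpChord ε) where
  full := fullChord_of_jumpChord hε h1
  belowChord hg _ hx i := belowChord_univ_of_jump hε h1 hg hx i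

variable {𝒞 : ℝ → ℝ → ℝ → Prop} {f : (Fin n → ℤˣ) → ℤˣ}

/-- Vertices are solved, so the bound holds there; the chords from `-1` to `1` free one coordinate
at a time. This makes the supremum defining the envelope finite. -/
lemma IsMinorant.le_natCast (h𝒞 : IsChordSystem n 𝒞) {g : (Fin n → ℝ) → ℝ}
    (hg : IsMinorant 𝒞 f g) {x : Fin n → ℝ} (hx : x ∈ cube n) : g x ≤ n := by
  suffices h : ∀ S : Finset (Fin n), ∀ x ∈ cube n, (∀ i ∉ S, x i = -1 ∨ x i = 1) → g x ≤ n from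
    h Finset.univ x hx (by simp)
  intro S
  induction S using Finset.induction_on with
  | empty =>
    intro x hx hS
    exact (hg.2 x hx (vertices_subset_solved f (mem_vertices.2 fun i => hS i (by simp)))).trans
      (sqSum_le hx)
  | insert a S ha ih =>
    intro x hx hS
    have hb : ∀ t : ℝ, t = -1 ∨ t = 1 → g (Function.update x a t) ≤ n := by
      intro t ht
      refine ih _ (update_mem_cube hx a (by rcases ht with rfl | rfl <;> simp)) fun i hi => ?_
      rcases eq_or_ne i a with rfl | hia
      · simpa using ht
      · simpa [hia] using hS i (by simp [hia, hi])
    have hch := h𝒞.belowChord hg.1 x hx a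
    unfold BelowChord at hch
    have hxa := mem_cube.1 hx a
    nlinarith [mul_le_mul_of_nonneg_left (hb (-1) (by simp)) (by linarith [hxa.2] : 0 ≤ 1 - x a),
      mul_le_mul_of_nonneg_left (hb 1 (by simp)) (by linarith [hxa.1] : 0 ≤ x a - -1)]

/-- The squared norm is separately convex. It makes the set of minorants nonempty and gives the
lower bound by which the envelope equals `sqSum` on solved points. -/
lemma isMinorant_sqSum (h𝒞 : IsChordSystem n 𝒞) : IsMinorant 𝒞 f sqSum := by
  refine ⟨fun x _ i a b h => ?_, fun _ _ _ => le_rfl⟩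
  obtain ⟨-, h1, h2, -⟩ := h𝒞.full h
  simp only [BelowChord, sqSum_update]
  nlinarith [mul_nonneg (mul_nonneg (sub_nonneg.2 h1) (sub_nonneg.2 h2))
    (by linarith : 0 ≤ b - a)]

lemma IsMinorant.le_envelope (h𝒞 : IsChordSystem n 𝒞) {g : (Fin n → ℝ) → ℝ}
    (hg : IsMinorant 𝒞 f g) {x : Fin n → ℝ} (hx : x ∈ cube n) : g x ≤ envelope 𝒞 f x := by
  refine le_csSup ⟨n, ?_⟩ ⟨g, hg, rfl⟩
  rintro _ ⟨g, hg, rfl⟩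
  exact hg.le_natCast h𝒞 hx

lemma envelope_le (h𝒞 : IsChordSystem n 𝒞) {x : Fin n → ℝ} {c : ℝ}
    (h : ∀ g, IsMinorant 𝒞 f g → g x ≤ c) : envelope 𝒞 f x ≤ c := by
  refine csSup_le ⟨_, sqSum, isMinorant_sqSum h𝒞, rfl⟩ ?_
  rintro _ ⟨g, hg, rfl⟩
  exact h g hg

/-- Chord inequalities have nonnegative weights and so pass to suprema. The chord with `a = b` is
treated apart because the argument divides by `b - a`. -/
lemma isMinorant_envelope (h𝒞 : IsChordSystem n 𝒞) : IsMinorant 𝒞 f (envelope 𝒞 f) := by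
  refine ⟨fun x hx i a b h => ?_, fun z hz hf => envelope_le h𝒞 fun g hg => hg.2 z hz hf⟩
  obtain ⟨h1, h2, h3, h4⟩ := h𝒞.full h
  have ha : Function.update x i a ∈ cube n := update_mem_cube hx i ⟨h1, by linarith⟩
  have hb : Function.update x i b ∈ cube n := update_mem_cube hx i ⟨by linarith, h4⟩
  have key : ∀ g, IsMinorant 𝒞 f g → (b - a) * g x ≤
      (b - x i) * envelope 𝒞 f (Function.update x i a) +
        (x i - a) * envelope 𝒞 f (Function.update x i b) := fun g hg => by
    have := hg.1 x hx i a b h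
    unfold BelowChord at this
    have e1 := mul_le_mul_of_nonneg_left (hg.le_envelope h𝒞 ha) (by linarith : 0 ≤ b - x i)
    have e2 := mul_le_mul_of_nonneg_left (hg.le_envelope h𝒞 hb) (by linarith : 0 ≤ x i - a)
    linarith
  unfold BelowChord
  rcases eq_or_lt_of_le (h2.trans h3) with hab | hab
  · have : x i = a := le_antisymm (by linarith) h2
    subst hab; simp [this]
  · rw [← le_div_iff₀' (by linarith)]
    refine envelope_le h𝒞 fun g hg => ?_
    rw [le_div_iff₀' (by linarith)]
    exact key g hg

lemma envelope_le_natCast (h𝒞 : IsChordSystem n 𝒞) {x : Fin n → ℝ} (hx : x ∈ cube n) :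
    envelope 𝒞 f x ≤ n := (isMinorant_envelope h𝒞).le_natCast h𝒞 hx

lemma sqSum_le_envelope (h𝒞 : IsChordSystem n 𝒞) {x : Fin n → ℝ} (hx : x ∈ cube n) :
    sqSum x ≤ envelope 𝒞 f x := (isMinorant_sqSum h𝒞).le_envelope h𝒞 hx

lemma envelope_nonneg (h𝒞 : IsChordSystem n 𝒞) {x : Fin n → ℝ} (hx : x ∈ cube n) :
    0 ≤ envelope 𝒞 f x := (sqSum_nonneg x).trans (sqSum_le_envelope h𝒞 hx)

lemma envelope_eq_of_mem_solved (h𝒞 : IsChordSystem n 𝒞) {x : Fin n → ℝ} (hx : x ∈ cube n)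
    (hf : x ∈ solved f) : envelope 𝒞 f x = sqSum x :=
  le_antisymm ((isMinorant_envelope h𝒞).2 x hx hf) (sqSum_le_envelope h𝒞 hx)

/-- Separately convex minorants are minorants for every chord system. -/
lemma envelope_fullChord_le (h𝒞 : IsChordSystem n 𝒞) {x : Fin n → ℝ} (hx : x ∈ cube n) :
    envelope fullChord f x ≤ envelope 𝒞 f x :=
  IsMinorant.le_envelope h𝒞
    ⟨fun x hx i a b h =>
      (isMinorant_envelope isChordSystem_fullChord).1 x hx i a b (h𝒞.full h),
      (isMinorant_envelope isChordSystem_fullChord).2⟩ hx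

end

end AxisAligned

/-! ### Continuity of `W` and the convergence `W_ε → W`. -/

namespace AxisAligned

noncomputable section

variable {n : ℕ}

/-! ### Lipschitz continuity of the separately convex envelope -/

variable {𝒞 : ℝ → ℝ → ℝ → Prop} {f : (Fin n → ℤˣ) → ℤˣ}

/-- Near the face `xᵢ = e` the separately convex envelope does not drop steeply. -/
lemma envelope_update_le {x : Fin n → ℝ} (hx : x ∈ cube n) (i : Fin n) {e : ℝ}
    (he : e = -1 ∨ e = 1) :
    envelope fullChord f (Function.update x i e) ≤
      envelope fullChord f x + (n + 2) * (1 - e * x i) := by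
  set W := envelope fullChord f with hW
  have hee : e ∈ Set.Icc (-1 : ℝ) 1 := by rcases he with rfl | rfl <;> simp
  have he2 : e * e = 1 := by rcases he with rfl | rfl <;> norm_num
  have hWm : IsMinorant fullChord f W := isMinorant_envelope isChordSystem_fullChord
  -- The comparison function is affine in `x i` and inherits convexity in the other coordinates from
  -- `W` on the face.
  suffices h : IsMinorant fullChord f
      (fun x => W (Function.update x i e) - (n + 2) * (1 - e * x i)) by
    have := h.le_envelope isChordSystem_fullChord hx
    linarith
  refine ⟨fun x hx j a b h => ?_, fun z hz hf => ?_⟩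
  · simp only [BelowChord]
    rcases eq_or_ne j i with rfl | hj
    · simp only [Function.update_idem, Function.update_self]
      apply le_of_eq; ring
    · have := hWm.1 _ (update_mem_cube hx i hee) j a b (by simpa [hj] using h)
      simp only [BelowChord, Function.update_of_ne hj, Function.update_of_ne hj.symm] at this ⊢
      rw [Function.update_comm hj a e x, Function.update_comm hj b e x]
      linarith
  · simp only
    have hzi := mem_cube.1 hz i
    have hn : (0 : ℝ) ≤ n := Nat.cast_nonneg n
    have h0 : 0 ≤ 1 - e * z i := by rcases he with rfl | rfl <;> linarith [hzi.1, hzi.2]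
    by_cases h : Function.update z i e ∈ solved f
    -- Moving to the face raises the squared norm by `1 - z i ^ 2 = (1 - e * z i) * (1 + e * z i)`,
    -- and the last factor is at most `2`.
    · have h1 := hWm.2 _ (update_mem_cube hz i hee) h
      rw [sqSum_update] at h1
      have h2 : 0 ≤ 1 + e * z i := by rcases he with rfl | rfl <;> linarith [hzi.1, hzi.2]
      have h3 : e ^ 2 - z i ^ 2 = (1 - e * z i) * (1 + e * z i) := by
        have : (1 - e * z i) * (1 + e * z i) = 1 - (e * e) * z i ^ 2 := by ring
        rw [this, he2]; nlinarith
      nlinarith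
    -- Solvedness can be lost only from the opposite face. There the penalty is `2 * (n + 2)`, which
    -- exceeds the crude bound `W ≤ n`.
    · have hz1 : z i = -e := by
        by_contra hne
        apply h
        by_cases hze : z i = e
        · rw [← hze, Function.update_eq_self]; exact hf
        · exact update_mem_solved hz hf (mem_Ioo_of_ne hzi
            (by rcases he with rfl | rfl <;> simp_all)
            (by rcases he with rfl | rfl <;> simp_all)) _
      have h1 := hWm.le_natCast isChordSystem_fullChord (update_mem_cube hz i hee)
      have h2 := sqSum_nonneg z
      have : 1 - e * z i = 2 := by rw [hz1]; linarith
      rw [this]; linarith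

/-- The chord runs from the position `t` through `x i` to the face beyond it. The slope bound at
that face, used for the point at `t`, controls the face value, and the chord length cancels. -/
lemma envelope_le_update_add {x : Fin n → ℝ} (hx : x ∈ cube n) (i : Fin n) {t : ℝ}
    (ht : t ∈ Set.Icc (-1 : ℝ) 1) :
    envelope fullChord f x ≤
      envelope fullChord f (Function.update x i t) + (n + 2) * |x i - t| := by
  set W := envelope fullChord f with hW
  have hWm : IsMinorant fullChord f W := isMinorant_envelope isChordSystem_fullChord
  have hxi := mem_cube.1 hx i
  have hu := update_mem_cube hx i ht
  rcases lt_trichotomy (x i) t with h | h | h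
  · have h1 := hWm.1 x hx i (-1) t ⟨le_rfl, hxi.1, h.le, ht.2⟩
    have h2 := envelope_update_le (f := f) hu i (e := -1) (by simp)
    simp only [Function.update_idem, Function.update_self] at h2
    rw [BelowChord] at h1
    rw [abs_of_neg (by linarith)]
    refine le_of_mul_le_mul_left ?_ (by linarith [hxi.1] : 0 < t - -1)
    nlinarith [mul_le_mul_of_nonneg_left h2 (by linarith : 0 ≤ t - x i)]
  · rw [← h, Function.update_eq_self]; simp
  · have h1 := hWm.1 x hx i t 1 ⟨ht.1, h.le, hxi.2, le_rfl⟩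
    have h2 := envelope_update_le (f := f) hu i (e := 1) (by simp)
    simp only [Function.update_idem, Function.update_self] at h2
    rw [BelowChord] at h1
    rw [abs_of_pos (by linarith)]
    refine le_of_mul_le_mul_left ?_ (by linarith [hxi.2] : 0 < 1 - t)
    nlinarith [mul_le_mul_of_nonneg_left h2 (by linarith : 0 ≤ x i - t)]

lemma envelope_le_add_sum {x y : Fin n → ℝ} (hx : x ∈ cube n) (hy : y ∈ cube n) :
    envelope fullChord f x ≤ envelope fullChord f y + (n + 2) * ∑ i, |x i - y i| := by
  have := le_piecewise_add_sum (F := envelope fullChord f) hy Finset.univ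
    (fun x hx i _ => envelope_le_update_add hx i (mem_cube.1 hy i)) hx
  simpa using this

lemma continuousOn_envelope : ContinuousOn (envelope fullChord f) (cube n) := by
  intro x hx
  have hlim : Tendsto (fun y : Fin n → ℝ => (n + 2 : ℝ) * ∑ i, |y i - x i|) (𝓝[cube n] x)
      (𝓝 0) := by
    have : Continuous fun y : Fin n → ℝ => (n + 2 : ℝ) * ∑ i, |y i - x i| := by fun_prop
    have h := this.tendsto x
    simp only [sub_self, abs_zero, Finset.sum_const_zero, mul_zero] at h
    exact h.mono_left nhdsWithin_le_nhds
  rw [ContinuousWithinAt, tendsto_iff_dist_tendsto_zero]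
  refine squeeze_zero' (Eventually.of_forall fun _ => dist_nonneg) ?_ hlim
  filter_upwards [self_mem_nhdsWithin] with y hy
  rw [Real.dist_eq, abs_le]
  have h1 := envelope_le_add_sum (f := f) hx hy
  have h2 := envelope_le_add_sum (f := f) hy hx
  simp only [abs_sub_comm (x _)] at h1
  constructor <;> linarith

/-! ### Convergence of the jump envelopes -/

/-- Times tending to infinity and points of the cube tending to `x`. -/
def relaxedFilter (x : Fin n → ℝ) : Filter (ℕ × (Fin n → ℝ)) := atTop ×ˢ 𝓝[cube n] x

/-- The upper half-relaxed limit of the jump envelopes. -/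
def relaxedLimit (f : (Fin n → ℤˣ) → ℤˣ) (x : Fin n → ℝ) : ℝ :=
  sInf {c | ∀ᶠ p in relaxedFilter x, envelope (jumpChord ((1 / 2 : ℝ) ^ p.1)) f p.2 ≤ c}

lemma halfPow_pos (k : ℕ) : (0 : ℝ) < (1 / 2 : ℝ) ^ k := by positivity

lemma halfPow_le_one (k : ℕ) : (1 / 2 : ℝ) ^ k ≤ 1 := pow_le_one₀ (by norm_num) (by norm_num)

lemma isChordSystem_halfPow (k : ℕ) : IsChordSystem n (jumpChord ((1 / 2 : ℝ) ^ k)) :=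
  isChordSystem_jumpChord (halfPow_pos k) (halfPow_le_one k)

lemma relaxedFilter_neBot {x : Fin n → ℝ} (hx : x ∈ cube n) : (relaxedFilter x).NeBot := by
  have : (𝓝[cube n] x).NeBot := mem_closure_iff_nhdsWithin_neBot.1 (subset_closure hx)
  unfold relaxedFilter
  infer_instance

lemma eventually_mem_cube (x : Fin n → ℝ) : ∀ᶠ p in relaxedFilter x, p.2 ∈ cube n :=
  tendsto_snd.eventually self_mem_nhdsWithin

lemma tendsto_relaxed_snd (x : Fin n → ℝ) :
    Tendsto (fun p : ℕ × (Fin n → ℝ) => p.2) (relaxedFilter x) (𝓝 x) :=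
  tendsto_snd.mono_right nhdsWithin_le_nhds

lemma tendsto_relaxed_halfPow (x : Fin n → ℝ) :
    Tendsto (fun p : ℕ × (Fin n → ℝ) => (1 / 2 : ℝ) ^ p.1) (relaxedFilter x) (𝓝 0) :=
  (tendsto_pow_atTop_nhds_zero_of_lt_one (by norm_num) (by norm_num)).comp tendsto_fst

/-- The envelopes are nonnegative and the filter is nontrivial, so the `sInf` is over a set bounded
below and is a genuine infimum. -/
lemma relaxedLimit_le {x : Fin n → ℝ} (hx : x ∈ cube n) {c : ℝ}
    (h : ∀ᶠ p in relaxedFilter x, envelope (jumpChord ((1 / 2 : ℝ) ^ p.1)) f p.2 ≤ c) :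
    relaxedLimit f x ≤ c := by
  refine csInf_le ⟨0, fun c hc => ?_⟩ h
  have := relaxedFilter_neBot hx
  have hc' : ∀ᶠ p in relaxedFilter x, envelope (jumpChord ((1 / 2 : ℝ) ^ p.1)) f p.2 ≤ c := hc
  obtain ⟨p, hp, hp'⟩ := (hc'.and (eventually_mem_cube x)).exists
  exact (envelope_nonneg (isChordSystem_halfPow p.1) hp').trans hp

lemma eventually_le_of_relaxedLimit_lt {x : Fin n → ℝ} {c : ℝ} (h : relaxedLimit f x < c) :
    ∀ᶠ p in relaxedFilter x, envelope (jumpChord ((1 / 2 : ℝ) ^ p.1)) f p.2 ≤ c := by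
  have hne : {c | ∀ᶠ p in relaxedFilter x,
      envelope (jumpChord ((1 / 2 : ℝ) ^ p.1)) f p.2 ≤ c}.Nonempty :=
    ⟨n, (eventually_mem_cube x).mono fun p hp =>
      envelope_le_natCast (isChordSystem_halfPow p.1) hp⟩
  obtain ⟨c', hc', hlt⟩ := exists_lt_of_csInf_lt hne h
  exact Eventually.mono hc' fun p hp => hp.trans hlt.le

/-- Near a face the jump envelope is at most slightly larger than on the face. -/
lemma envelope_jump_le_update_add {ε : ℝ} (hε : 0 < ε) (h1 : ε ≤ 1) {x : Fin n → ℝ}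
    (hx : x ∈ cube n) (i : Fin n) {e : ℝ} (he : e = -1 ∨ e = 1) :
    envelope (jumpChord ε) f x ≤
      envelope (jumpChord ε) f (Function.update x i e) + n * |x i - e| := by
  have h𝒞 := isChordSystem_jumpChord (n := n) hε h1
  have hch := h𝒞.belowChord (isMinorant_envelope (f := f) h𝒞).1 x hx i
  rw [BelowChord] at hch
  have hxi := mem_cube.1 hx i
  have m1 : Function.update x i (-1) ∈ cube n := update_mem_cube hx i (by simp)
  have m2 : Function.update x i 1 ∈ cube n := update_mem_cube hx i (by simp)
  have b1 := envelope_le_natCast (f := f) h𝒞 m1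
  have b2 := envelope_le_natCast (f := f) h𝒞 m2
  have c1 := envelope_nonneg (f := f) h𝒞 m1
  have c2 := envelope_nonneg (f := f) h𝒞 m2
  have hn : (0 : ℝ) ≤ n := Nat.cast_nonneg n
  rcases he with rfl | rfl
  · rw [abs_of_nonneg (by linarith [hxi.1])]
    nlinarith [mul_le_mul_of_nonneg_left b2 (by linarith [hxi.1] : 0 ≤ x i - -1),
      mul_nonneg c1 (by linarith [hxi.1] : 0 ≤ x i - -1),
      mul_nonneg hn (by linarith [hxi.1] : 0 ≤ x i - -1)]
  · rw [abs_of_nonpos (by linarith [hxi.2])]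
    nlinarith [mul_le_mul_of_nonneg_left b1 (by linarith [hxi.2] : 0 ≤ 1 - x i),
      mul_nonneg c2 (by linarith [hxi.2] : 0 ≤ 1 - x i),
      mul_nonneg hn (by linarith [hxi.2] : 0 ≤ 1 - x i)]

/-- Points near a solved `z` need not be solved. Putting the coordinates in which `z` is `±1` back
on their faces costs little; the others are interior for `z`, so they may vary freely without
leaving the solved set. -/
lemma relaxedLimit_le_sqSum {z : Fin n → ℝ} (hz : z ∈ cube n) (hf : z ∈ solved f) :
    relaxedLimit f z ≤ sqSum z := by
  set S : Finset (Fin n) := {i | z i = -1 ∨ z i = 1} with hS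
  have hb : ∀ᶠ p in relaxedFilter z, envelope (jumpChord ((1 / 2 : ℝ) ^ p.1)) f p.2 ≤
      sqSum (S.piecewise z p.2) + n * ∑ i ∈ S, |p.2 i - z i| := by
    filter_upwards [eventually_mem_cube z] with p hp
    refine (le_piecewise_add_sum hz S (fun x hx i hi => envelope_jump_le_update_add
      (halfPow_pos _) (halfPow_le_one _) hx i (by simpa [hS] using hi)) hp).trans ?_
    have hm := piecewise_mem_cube hp hz S
    refine add_le_add_left ((isMinorant_envelope (isChordSystem_halfPow p.1)).2 _ hm ?_) _
    have := piecewise_mem_solved hz hp hf Sᶜ fun i hi => by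
      simp only [hS, Finset.mem_compl, Finset.mem_filter, Finset.mem_univ, true_and,
        not_or] at hi
      exact mem_Ioo_of_ne (mem_cube.1 hz i) hi.1 hi.2
    rwa [Finset.piecewise_compl] at this
  have hlim : Tendsto (fun p : ℕ × (Fin n → ℝ) =>
      sqSum (S.piecewise z p.2) + n * ∑ i ∈ S, |p.2 i - z i|) (relaxedFilter z)
      (𝓝 (sqSum z)) := by
    have hc : Continuous fun y : Fin n → ℝ =>
        sqSum (S.piecewise z y) + n * ∑ i ∈ S, |y i - z i| := by
      refine (continuous_sqSum.comp (continuous_pi fun i => ?_)).add (by fun_prop)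
      by_cases hi : i ∈ S
      · simpa [hi] using continuous_const
      · simpa [hi] using continuous_apply i
    have := (hc.tendsto z).comp (tendsto_relaxed_snd z)
    simpa [Finset.piecewise_same, Function.comp_def] using this
  refine le_of_forall_gt fun c hc => ?_
  obtain ⟨c', h1, h2⟩ := exists_between hc
  refine lt_of_le_of_lt (relaxedLimit_le hz ?_) h2
  filter_upwards [hb, hlim.eventually_lt_const h1] with p hp hp'
  exact hp.trans hp'.le

/-- Rounding `s` down to a multiple of a step size which tends to `0`. -/
lemma tendsto_floor_mul {α : Type*} {l : Filter α} {ε s : α → ℝ} {a : ℝ}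
    (hε : Tendsto ε l (𝓝 0)) (hpos : ∀ p, 0 < ε p) (hs : Tendsto s l (𝓝 a))
    (hs0 : ∀ᶠ p in l, 0 ≤ s p) : Tendsto (fun p => (⌊s p / ε p⌋₊ : ℝ) * ε p) l (𝓝 a) := by
  refine tendsto_of_tendsto_of_tendsto_of_le_of_le' (g := fun p => s p - ε p)
    (by simpa using hs.sub hε) hs ?_ ?_
  · refine Eventually.of_forall fun p => ?_
    have := (Nat.lt_floor_add_one (s p / ε p)).le
    rw [div_le_iff₀ (hpos p)] at this
    linarith
  · filter_upwards [hs0] with p hp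
    have := Nat.floor_le (div_nonneg hp (hpos p).le)
    rwa [le_div_iff₀ (hpos p)] at this

lemma tendsto_update_relaxed {x : Fin n → ℝ} (i : Fin n) {s : ℕ × (Fin n → ℝ) → ℝ} {t : ℝ}
    (hs : Tendsto s (relaxedFilter x) (𝓝 t))
    (hs1 : ∀ᶠ p in relaxedFilter x, s p ∈ Set.Icc (-1 : ℝ) 1) :
    Tendsto (fun p => (p.1, Function.update p.2 i (s p))) (relaxedFilter x)
      (relaxedFilter (Function.update x i t)) := by
  refine Tendsto.prodMk tendsto_fst (tendsto_nhdsWithin_iff.2 ⟨?_, ?_⟩)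
  · exact (tendsto_relaxed_snd x).update i hs
  · filter_upwards [eventually_mem_cube x, hs1] with p hp hp'
    exact update_mem_cube hp i hp'

/-- From a nearby point one walks whole numbers of `ε`-steps, of total lengths `L` down and `R` up
tending to `x i - a` and `b - x i`. The jump envelope lies below this chord, whose ends tend to the
ends of the given one. Since the relaxed limit allows points to move, it absorbs both the displaced
start and the rounding. -/
lemma isMinorant_relaxedLimit : IsMinorant fullChord f (relaxedLimit f) := by
  refine ⟨fun x hx i a b ⟨ha, hax, hxb, hb⟩ => ?_, fun z hz hf => relaxedLimit_le_sqSum hz hf⟩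
  rcases eq_or_lt_of_le (hax.trans hxb) with hab | hab
  · have : x i = a := le_antisymm (by linarith) hax
    subst hab; simp [BelowChord, this]
  have hA : Function.update x i a ∈ cube n := update_mem_cube hx i ⟨ha, by linarith⟩
  have hB : Function.update x i b ∈ cube n := update_mem_cube hx i ⟨by linarith, hb⟩
  suffices key : ∀ c₁ c₂, relaxedLimit f (Function.update x i a) < c₁ →
      relaxedLimit f (Function.update x i b) < c₂ →
      (b - a) * relaxedLimit f x ≤ (b - x i) * c₁ + (x i - a) * c₂ by
    rw [BelowChord]
    refine le_of_forall_pos_le_add fun δ hδ => ?_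
    have := key (relaxedLimit f (Function.update x i a) + δ / (b - a))
      (relaxedLimit f (Function.update x i b) + δ / (b - a))
      (by simp; exact div_pos hδ (by linarith)) (by simp; exact div_pos hδ (by linarith))
    have e : (b - x i) * (δ / (b - a)) + (x i - a) * (δ / (b - a)) = δ := by
      field_simp [(sub_pos.2 hab).ne']
      ring
    linarith
  intro c₁ c₂ hc₁ hc₂
  set ε : ℕ × (Fin n → ℝ) → ℝ := fun p => (1 / 2 : ℝ) ^ p.1 with hε
  have hεp : ∀ p, 0 < ε p := fun p => halfPow_pos p.1
  have hxl : Tendsto (fun p : ℕ × (Fin n → ℝ) => p.2 i) (relaxedFilter x) (𝓝 (x i)) :=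
    ((continuous_apply i).tendsto x).comp (tendsto_relaxed_snd x)
  -- The start `p.2 i` differs from `x i`, so the lengths are truncated to keep the walk in
  -- `[-1,1]`; the truncation disappears in the limit.
  set u : ℕ × (Fin n → ℝ) → ℝ := fun p => min (x i - a) (p.2 i + 1) with hu
  set v : ℕ × (Fin n → ℝ) → ℝ := fun p => min (b - x i) (1 - p.2 i) with hv
  have hul : Tendsto u (relaxedFilter x) (𝓝 (x i - a)) := by
    have := (tendsto_const_nhds (x := x i - a)).min (hxl.add_const 1)
    rwa [min_eq_left (by linarith)] at this
  have hvl : Tendsto v (relaxedFilter x) (𝓝 (b - x i)) := by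
    have := (tendsto_const_nhds (x := b - x i)).min (hxl.const_sub 1)
    rwa [min_eq_left (by linarith)] at this
  have hu0 : ∀ᶠ p in relaxedFilter x, 0 ≤ u p := by
    filter_upwards [eventually_mem_cube x] with p hp
    exact le_min (by linarith) (by linarith [(mem_cube.1 hp i).1])
  have hv0 : ∀ᶠ p in relaxedFilter x, 0 ≤ v p := by
    filter_upwards [eventually_mem_cube x] with p hp
    exact le_min (by linarith) (by linarith [(mem_cube.1 hp i).2])
  have hL := tendsto_floor_mul (tendsto_relaxed_halfPow x) hεp hul hu0
  have hR := tendsto_floor_mul (tendsto_relaxed_halfPow x) hεp hvl hv0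
  set L : ℕ × (Fin n → ℝ) → ℝ := fun p => (⌊u p / ε p⌋₊ : ℝ) * ε p with hLdef
  set R : ℕ × (Fin n → ℝ) → ℝ := fun p => (⌊v p / ε p⌋₊ : ℝ) * ε p with hRdef
  have hLu : ∀ᶠ p in relaxedFilter x, L p ≤ u p ∧ 0 ≤ L p := by
    filter_upwards [hu0] with p hp
    have := Nat.floor_le (div_nonneg hp (hεp p).le)
    rw [le_div_iff₀ (hεp p)] at this
    exact ⟨this, mul_nonneg (Nat.cast_nonneg _) (hεp p).le⟩
  have hRv : ∀ᶠ p in relaxedFilter x, R p ≤ v p ∧ 0 ≤ R p := by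
    filter_upwards [hv0] with p hp
    have := Nat.floor_le (div_nonneg hp (hεp p).le)
    rw [le_div_iff₀ (hεp p)] at this
    exact ⟨this, mul_nonneg (Nat.cast_nonneg _) (hεp p).le⟩
  have hLin : ∀ᶠ p in relaxedFilter x, p.2 i - L p ∈ Set.Icc (-1 : ℝ) 1 := by
    filter_upwards [hLu, eventually_mem_cube x] with p hp hp'
    have := min_le_right (x i - a) (p.2 i + 1)
    exact ⟨by linarith [hp.1], by linarith [hp.2, (mem_cube.1 hp' i).2]⟩
  have hRin : ∀ᶠ p in relaxedFilter x, p.2 i + R p ∈ Set.Icc (-1 : ℝ) 1 := by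
    filter_upwards [hRv, eventually_mem_cube x] with p hp hp'
    have := min_le_right (b - x i) (1 - p.2 i)
    exact ⟨by linarith [hp.2, (mem_cube.1 hp' i).1], by linarith [hp.1]⟩
  have hLc := (tendsto_update_relaxed i (t := a) (by simpa using hxl.sub hL) hLin).eventually
    (eventually_le_of_relaxedLimit_lt hc₁)
  have hRc := (tendsto_update_relaxed i (t := b) (by simpa using hxl.add hR) hRin).eventually
    (eventually_le_of_relaxedLimit_lt hc₂)
  have hlim : Tendsto (fun p => (R p * c₁ + L p * c₂) / (R p + L p)) (relaxedFilter x)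
      (𝓝 (((b - x i) * c₁ + (x i - a) * c₂) / ((b - x i) + (x i - a)))) :=
    ((hR.mul_const c₁).add (hL.mul_const c₂)).div (hR.add hL) (by linarith)
  have hpos : ∀ᶠ p in relaxedFilter x, 0 < R p + L p :=
    (hR.add hL).eventually_const_lt (by linarith)
  have hle : ∀ᶠ p in relaxedFilter x, envelope (jumpChord (ε p)) f p.2 ≤
      (R p * c₁ + L p * c₂) / (R p + L p) := by
    filter_upwards [eventually_mem_cube x, hLu, hRv, hLin, hRin, hLc, hRc, hpos] with
      p hp h1 h2 h3 h4 h5 h6 h7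
    have := belowChord_steps (hεp p)
      (isMinorant_envelope (f := f) (isChordSystem_halfPow p.1)).1 hp i ⌊u p / ε p⌋₊
      ⌊v p / ε p⌋₊ h3.1 h4.2
    change BelowChord _ _ _ (p.2 i - L p) (p.2 i + R p) at this
    rw [BelowChord] at this
    rw [le_div_iff₀ h7]
    have e1 := mul_le_mul_of_nonneg_left h5 h2.2
    have e2 := mul_le_mul_of_nonneg_left h6 h1.2
    linarith
  have hrel : relaxedLimit f x ≤
      ((b - x i) * c₁ + (x i - a) * c₂) / ((b - x i) + (x i - a)) := by
    refine le_of_forall_gt fun c hc => ?_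
    obtain ⟨c', h1, h2⟩ := exists_between hc
    refine lt_of_le_of_lt (relaxedLimit_le hx ?_) h2
    filter_upwards [hle, hlim.eventually_lt_const h1] with p hp hp'
    exact hp.trans hp'.le
  rw [show (b - x i) + (x i - a) = b - a by ring, le_div_iff₀' (by linarith)] at hrel
  exact hrel

/-- The jump envelopes converge to the separately convex envelope. -/
lemma tendsto_envelope_jump {x : Fin n → ℝ} (hx : x ∈ cube n) :
    Tendsto (fun k : ℕ => envelope (jumpChord ((1 / 2 : ℝ) ^ k)) f x) atTop
      (𝓝 (envelope fullChord f x)) := by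
  refine tendsto_order.2 ⟨fun c hc => Eventually.of_forall fun k =>
    hc.trans_le (envelope_fullChord_le (isChordSystem_halfPow k) hx), fun c hc => ?_⟩
  -- Maximality of the separately convex envelope bounds the relaxed limit, hence eventually the
  -- envelopes at the fixed point `x`.
  have h1 := isMinorant_relaxedLimit.le_envelope isChordSystem_fullChord (f := f) hx
  obtain ⟨c', hc1, hc2⟩ := exists_between (h1.trans_lt hc)
  have hx' : Tendsto (fun k : ℕ => (k, x)) atTop (relaxedFilter x) :=
    tendsto_id.prodMk (tendsto_nhdsWithin_iff.2
      ⟨tendsto_const_nhds, Eventually.of_forall fun _ => hx⟩)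
  filter_upwards [hx'.eventually (eventually_le_of_relaxedLimit_lt hc1)] with k hk
  exact lt_of_le_of_lt hk hc2

end

end AxisAligned

/-! ### The viscosity equation for `W - |x|²`. -/

namespace AxisAligned

noncomputable section

variable {n : ℕ}

/-! ### Second differences -/

lemma update_add (x : Fin n → ℝ) (i : Fin n) (s : ℝ) :
    Function.update x i (x i + s) = x + s • Pi.single i (1 : ℝ) := by
  ext j
  rcases eq_or_ne j i with rfl | hj
  · simp
  · simp [hj]

lemma sqSum_add (x : Fin n → ℝ) (i : Fin n) (s : ℝ) :
    sqSum (x + s • Pi.single i (1 : ℝ)) = sqSum x + 2 * s * x i + s ^ 2 := by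
  rw [← update_add, sqSum_update]; ring

/-- The partial derivative of `φ` in direction `k`. -/
def partialDeriv (k : Fin n) (φ : (Fin n → ℝ) → ℝ) (x : Fin n → ℝ) : ℝ :=
  fderiv ℝ φ x (Pi.single k 1)

variable {φ : (Fin n → ℝ) → ℝ}

lemma contDiff_partialDeriv (hφ : ContDiff ℝ ((⊤ : ℕ∞) : WithTop ℕ∞) φ) (k : Fin n) :
    ContDiff ℝ ((⊤ : ℕ∞) : WithTop ℕ∞) (partialDeriv k φ) :=
  (hφ.fderiv_right (m := ((⊤ : ℕ∞) : WithTop ℕ∞)) le_rfl).clm_apply contDiff_const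

lemma hasDerivAt_line (hφ : ContDiff ℝ ((⊤ : ℕ∞) : WithTop ℕ∞) φ) (k : Fin n) (x : Fin n → ℝ)
    (s : ℝ) : HasDerivAt (fun s : ℝ => φ (x + s • Pi.single k (1 : ℝ)))
      (partialDeriv k φ (x + s • Pi.single k (1 : ℝ))) s := by
  have h1 : HasDerivAt (fun s : ℝ => x + s • Pi.single k (1 : ℝ))
      (Pi.single k (1 : ℝ) : Fin n → ℝ) s := by
    simpa using ((hasDerivAt_id s).smul_const (Pi.single k (1 : ℝ) : Fin n → ℝ)).const_add x
  exact ((hφ.differentiable (by simp)) _).hasFDerivAt.comp_hasDerivAt s h1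

lemma secondPartial_eq (hφ : ContDiff ℝ ((⊤ : ℕ∞) : WithTop ℕ∞) φ) (k : Fin n) (x : Fin n → ℝ) :
    secondPartial φ k x = partialDeriv k (partialDeriv k φ) x := by
  have h1 : deriv (fun s : ℝ => φ (x + s • Pi.single k (1 : ℝ))) =
      fun s => partialDeriv k φ (x + s • Pi.single k (1 : ℝ)) :=
    funext fun s => (hasDerivAt_line hφ k x s).deriv
  rw [secondPartial, iteratedDeriv_succ, iteratedDeriv_one, h1,
    (hasDerivAt_line (contDiff_partialDeriv hφ k) k x 0).deriv]
  simp

lemma continuous_secondPartial (hφ : ContDiff ℝ ((⊤ : ℕ∞) : WithTop ℕ∞) φ) (k : Fin n) :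
    Continuous (secondPartial φ k) := by
  rw [funext (secondPartial_eq hφ k)]
  exact (contDiff_partialDeriv (contDiff_partialDeriv hφ k) k).continuous

lemma secondPartial_neg (hφ : ContDiff ℝ ((⊤ : ℕ∞) : WithTop ℕ∞) φ) (k : Fin n)
    (x : Fin n → ℝ) : secondPartial (fun x => -φ x) k x = -secondPartial φ k x := by
  rw [secondPartial_eq hφ.neg, secondPartial_eq hφ]
  have h : ∀ ψ : (Fin n → ℝ) → ℝ, partialDeriv k (fun x => -ψ x) =
      fun x => -partialDeriv k ψ x := fun ψ => by
    funext y
    simp only [partialDeriv, fderiv_fun_neg, neg_apply]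
  rw [h, h]

/-- A lower bound on the second partial derivative bounds second differences from below. -/
lemma le_second_difference (hφ : ContDiff ℝ ((⊤ : ℕ∞) : WithTop ℕ∞) φ) (k : Fin n)
    (x : Fin n → ℝ) {m s : ℝ} (hs : 0 ≤ s)
    (h : ∀ t ∈ Set.Icc (-s) s, m ≤ secondPartial φ k (x + t • Pi.single k (1 : ℝ))) :
    m * s ^ 2 ≤ φ (x + s • Pi.single k (1 : ℝ)) + φ (x + (-s) • Pi.single k (1 : ℝ)) - 2 * φ x := by
  -- Subtracting the parabola with second derivative `m` leaves a convex function; its midpoint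
  -- inequality at `0` is the claim.
  set p : ℝ → ℝ := fun t => φ (x + t • Pi.single k (1 : ℝ)) - m / 2 * t ^ 2 with hp
  have hd1 : ∀ t, HasDerivAt p (partialDeriv k φ (x + t • Pi.single k (1 : ℝ)) - m * t) t :=
    fun t => by
      have := (hasDerivAt_line hφ k x t).fun_sub (((hasDerivAt_id t).fun_pow 2).const_mul (m / 2))
      refine this.congr_deriv ?_
      simp only [id, Nat.cast_ofNat]
      ring
  have hd2 : ∀ t, HasDerivAt (fun t => partialDeriv k φ (x + t • Pi.single k (1 : ℝ)) - m * t)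
      (secondPartial φ k (x + t • Pi.single k (1 : ℝ)) - m) t := fun t => by
    rw [secondPartial_eq hφ]
    simpa using (hasDerivAt_line (contDiff_partialDeriv hφ k) k x t).fun_sub
      ((hasDerivAt_id t).const_mul m)
  have hc : ConvexOn ℝ (Set.Icc (-s) s) p :=
    convexOn_of_hasDerivWithinAt2_nonneg (convex_Icc _ _)
      (fun t _ => (hd1 t).continuousAt.continuousWithinAt)
      (fun t _ => (hd1 t).hasDerivWithinAt) (fun t _ => (hd2 t).hasDerivWithinAt)
      (fun t ht => sub_nonneg.2 (h t (interior_subset ht)))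
  have hs1 : s ∈ Set.Icc (-s) s := ⟨by linarith, le_rfl⟩
  have hs2 : -s ∈ Set.Icc (-s) s := ⟨le_rfl, by linarith⟩
  have := hc.right hs1 hs2 (by norm_num : (0 : ℝ) ≤ 1 / 2) (by norm_num : (0 : ℝ) ≤ 1 / 2)
    (by norm_num)
  simp only [smul_eq_mul, hp] at this
  rw [show (1 / 2 : ℝ) * s + 1 / 2 * -s = 0 by ring, zero_smul, add_zero] at this
  linarith

lemma tendsto_line (x : Fin n → ℝ) (k : Fin n) :
    Tendsto (fun s : ℝ => x + s • Pi.single k (1 : ℝ)) (𝓝 0) (𝓝 x) := by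
  have : Continuous fun s : ℝ => x + s • (Pi.single k (1 : ℝ) : Fin n → ℝ) := by fun_prop
  simpa using this.tendsto 0

/-- A bound valid near `0` is valid on a symmetric interval. -/
lemma exists_forall_abs_le {P : ℝ → Prop} (h : ∀ᶠ s in 𝓝 0, P s) :
    ∃ δ > 0, ∀ s, |s| ≤ δ → P s := by
  obtain ⟨δ, hδ, h⟩ := Metric.eventually_nhds_iff.1 h
  exact ⟨δ / 2, by linarith, fun s hs => h (by rw [Real.dist_eq, sub_zero]; linarith)⟩

/-! ### The limit is a viscosity solution -/

variable {f : (Fin n → ℤˣ) → ℤˣ} {u : (Fin n → ℝ) → ℝ}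

/-- Up to a constant, `φ + |·|²` touches `W` from above. Midpoint convexity of `W` along each axis
makes its second differences there nonnegative, while `|·|²` contributes exactly `2 * δ ^ 2` to
them. -/
lemma isViscositySubsolution_of_eq (hn : 0 < n)
    (hu : ∀ x ∈ cube n, u x = envelope fullChord f x - sqSum x) :
    IsViscositySubsolution (openCube n) u (fun _ => -2) := by
  intro φ hφ x hx hmin
  have : Nonempty (Fin n) := ⟨⟨0, hn⟩⟩
  refine le_ciInf fun k => ?_
  by_contra! hlt
  obtain ⟨m, hm1, hm2⟩ := exists_between hlt
  have hW := (isMinorant_envelope (f := f) isChordSystem_fullChord).1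
  have hcube := openCube_subset_cube hx
  have e1 : ∀ᶠ s : ℝ in 𝓝 0, x + s • Pi.single k (1 : ℝ) ∈ cube n :=
    (tendsto_line x k).eventually (mem_of_superset (isOpen_openCube.mem_nhds hx)
      openCube_subset_cube)
  have e2 := (tendsto_line x k).eventually hmin
  have e3 : ∀ᶠ s : ℝ in 𝓝 0, secondPartial φ k (x + s • Pi.single k (1 : ℝ)) < m :=
    (tendsto_line x k).eventually
      (((continuous_secondPartial hφ k).tendsto x).eventually_lt_const hm1)
  obtain ⟨δ, hδ, H⟩ := exists_forall_abs_le (e1.and (e2.and e3))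
  have hp := H δ (by rw [abs_of_pos hδ])
  have hq := H (-δ) (by rw [abs_neg, abs_of_pos hδ])
  have hsd := le_second_difference (φ := fun x => -φ x) (m := -m) hφ.neg k x hδ.le
    fun t ht => by
      rw [secondPartial_neg hφ]
      linarith [(H t (abs_le.2 ht)).2.2]
  have hxk := mem_cube.1 hcube k
  have hup := mem_cube.1 hp.1 k
  have huq := mem_cube.1 hq.1 k
  rw [← update_add, Function.update_self] at hup huq
  have hch := hW x hcube k (x k + -δ) (x k + δ) ⟨huq.1, by linarith, by linarith, hup.2⟩
  rw [BelowChord, update_add, update_add] at hch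
  have hp2 := hp.2.1
  have hq2 := hq.2.1
  simp only [hu _ hcube, hu _ hp.1, hu _ hq.1, sqSum_add] at hp2 hq2
  have hch' : 2 * envelope fullChord f x ≤ envelope fullChord f (x + (-δ) • Pi.single k (1 : ℝ)) +
      envelope fullChord f (x + δ • Pi.single k (1 : ℝ)) := by
    refine le_of_mul_le_mul_left ?_ hδ
    linarith
  nlinarith [sq_pos_of_pos hδ]

/-- Balls in `Fin n → ℝ` are those of the maximum norm, whereas the bending term of the test
function is Euclidean. -/
lemma sq_norm_le_sqSum (x : Fin n → ℝ) : ‖x‖ ^ 2 ≤ sqSum x := by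
  have h : ‖x‖ ≤ Real.sqrt (sqSum x) := by
    refine (pi_norm_le_iff_of_nonneg (Real.sqrt_nonneg _)).2 fun i => ?_
    refine Real.le_sqrt_of_sq_le ?_
    rw [Real.norm_eq_abs, sq_abs]
    exact Finset.single_le_sum (f := fun i => x i ^ 2) (fun _ _ => sq_nonneg _)
      (Finset.mem_univ i)
  calc ‖x‖ ^ 2 ≤ Real.sqrt (sqSum x) ^ 2 := by gcongr
    _ = sqSum x := Real.sq_sqrt (sqSum_nonneg x)

/-- The maximum of the separately convex envelope and of a function `Ψ` which is midpoint convex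
in each direction near `x₀` and smaller than the envelope away from `x₀` is again a minorant. -/
lemma isMinorant_max {x₀ : Fin n → ℝ} {r : ℝ} (hr : 0 < r)
    (hf : ∀ z ∈ Metric.ball x₀ r, z ∉ solved f)
    {Ψ : (Fin n → ℝ) → ℝ} (hΨ : Continuous Ψ)
    (hlt : ∀ z ∈ Metric.ball x₀ r, r / 2 ≤ dist z x₀ → Ψ z ≤ envelope fullChord f z)
    (hconv : ∀ z i s, 0 ≤ s → dist z x₀ + s < r → 2 * Ψ z ≤
      Ψ (z + s • Pi.single i (1 : ℝ)) + Ψ (z + (-s) • Pi.single i (1 : ℝ))) :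
    IsMinorant fullChord f (fun z => open Classical in
      if z ∈ Metric.ball x₀ r then max (envelope fullChord f z) (Ψ z)
      else envelope fullChord f z) := by
  classical
  set W := envelope fullChord f with hWdef
  have hWm : IsMinorant fullChord f W := isMinorant_envelope isChordSystem_fullChord
  set g : (Fin n → ℝ) → ℝ := fun z => if z ∈ Metric.ball x₀ r then max (W z) (Ψ z) else W z
    with hg
  have hWg : ∀ z, W z ≤ g z := fun z => by
    simp only [hg]; split_ifs
    · exact le_max_left _ _
    · exact le_rfl
  have hΨg : ∀ z ∈ Metric.ball x₀ r, Ψ z ≤ g z := fun z hz => by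
    simp only [hg, if_pos hz]; exact le_max_right _ _
  -- On the shell from radius `r / 2` to `r` the maximum is already `W`, so the two definitions
  -- agree near the sphere.
  have hgc : ContinuousOn g (cube n) := by
    intro y hy
    by_cases hyb : y ∈ Metric.ball x₀ r
    · have h1 : ContinuousWithinAt (fun z => max (W z) (Ψ z)) (cube n) y :=
        (continuousOn_envelope y hy).sup hΨ.continuousWithinAt
      refine h1.congr_of_eventuallyEq (nhdsWithin_le_nhds ?_) (if_pos hyb)
      filter_upwards [Metric.isOpen_ball.mem_nhds hyb] with z hz
      exact if_pos hz
    · have hyd : r / 2 < dist y x₀ := by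
        rw [Metric.mem_ball, not_lt] at hyb; linarith
      refine (continuousOn_envelope (f := f) y hy).congr_of_eventuallyEq
        (nhdsWithin_le_nhds ?_) (if_neg hyb)
      have : ∀ᶠ z in 𝓝 y, r / 2 < dist z x₀ :=
        (continuous_id.dist continuous_const).tendsto y |>.eventually_const_lt hyd
      filter_upwards [this] with z hz
      simp only [hg]
      split_ifs with hzb
      · exact max_eq_left (hlt z hzb hz.le)
      · rfl
  refine ⟨fun x hx i a b ⟨ha, hax, hxb, hb⟩ => ?_, fun z hz hzf => ?_⟩
  · have hcube : ∀ t ∈ Set.Icc a b, Function.update x i t ∈ cube n := fun t ht =>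
      update_mem_cube hx i ⟨ha.trans ht.1, ht.2.trans hb⟩
    have key := le_chord_of_local (h := fun t => g (Function.update x i t))
      (isCompact_Icc (a := a) (b := b)) le_rfl
      (hgc.comp (by fun_prop) hcube) ?_
      (⟨hax, hxb⟩ : x i ∈ Set.Icc a b)
    · simpa [BelowChord] using key
    intro y hy hay hyb
    set z := Function.update x i y with hz
    have hzc : z ∈ cube n := hcube y hy
    have hzi : z i = y := by simp [hz]
    have hup : ∀ t, Function.update x i t = Function.update z i t := by simp [hz]
    have hWch : ∀ a' b', -1 ≤ a' → a' < y → y < b' → b' ≤ 1 → (b' - a') * W z ≤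
        (b' - y) * g (Function.update x i a') + (y - a') * g (Function.update x i b') := by
      intro a' b' h1 h2 h3 h4
      have := hWm.1 z hzc i a' b' ⟨h1, by linarith, by linarith, h4⟩
      rw [BelowChord, hzi, ← hup, ← hup] at this
      have e1 := mul_le_mul_of_nonneg_left (hWg (Function.update x i a')) (by linarith : 0 ≤ b' - y)
      have e2 := mul_le_mul_of_nonneg_left (hWg (Function.update x i b')) (by linarith : 0 ≤ y - a')
      linarith
    by_cases hzb : z ∈ Metric.ball x₀ r
    · have hd := Metric.mem_ball.1 hzb
      -- A short symmetric chord inside both `[a, b]` and the ball. Local chords suffice, and at `z`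
      -- one uses the convexity of whichever function attains the maximum.
      set s := min (min (y - a) (b - y)) ((r - dist z x₀) / 2) with hs
      have hs0 : 0 < s := lt_min (lt_min (by linarith) (by linarith)) (by linarith)
      have hs1 : s ≤ y - a := (min_le_left _ _).trans (min_le_left _ _)
      have hs2 : s ≤ b - y := (min_le_left _ _).trans (min_le_right _ _)
      have hs3 : dist z x₀ + s < r := by
        have : s ≤ (r - dist z x₀) / 2 := min_le_right _ _
        linarith
      have hin : ∀ t, |t| ≤ s → z + t • Pi.single i (1 : ℝ) ∈ Metric.ball x₀ r := by
        intro t ht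
        rw [Metric.mem_ball]
        refine lt_of_le_of_lt (dist_triangle _ z _) ?_
        have : dist (z + t • Pi.single i (1 : ℝ)) z ≤ s := by
          rw [dist_eq_norm, add_sub_cancel_left, norm_smul, Pi.norm_single]
          simpa using ht
        linarith
      refine ⟨y + -s, ⟨by linarith, by linarith⟩, y + s, ⟨by linarith, by linarith⟩,
        by linarith, by linarith, ?_⟩
      have hgz : g z = max (W z) (Ψ z) := if_pos hzb
      rw [hgz]
      rcases max_choice (W z) (Ψ z) with h | h <;> rw [h]
      · exact hWch _ _ (by linarith) (by linarith) (by linarith) (by linarith)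
      · have h1 := hconv z i s hs0.le hs3
        have h2 := hΨg _ (hin s (by rw [abs_of_pos hs0]))
        have h3 := hΨg _ (hin (-s) (by rw [abs_neg, abs_of_pos hs0]))
        rw [hup, hup, ← hzi, update_add, update_add, hzi]
        nlinarith
    · have hgz : g z = W z := if_neg hzb
      refine ⟨a, ⟨le_rfl, by linarith⟩, b, ⟨by linarith, le_rfl⟩, hay, hyb, ?_⟩
      rw [hgz]
      exact hWch a b ha hay hyb hb
  · have hzb : z ∉ Metric.ball x₀ r := fun h => hf z h hzf
    simp only [hg, if_neg hzb]
    exact hWm.2 z hz hzf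

/-- Otherwise `Ψ`, the sum `φ + |·|²` bent down and raised, is separately convex near `x`, exceeds
`W` by `δ` at `x` and is below `W` away from `x`. Its maximum with `W` contradicts the maximality of
`W`. -/
lemma isViscositySupersolution_of_eq (hf : ∀ z ∈ openCube n, z ∉ solved f)
    (hu : ∀ x ∈ cube n, u x = envelope fullChord f x - sqSum x) :
    IsViscositySupersolution (openCube n) u (fun _ => -2) := by
  classical
  intro φ hφ x hx hmax
  by_contra! hlt
  obtain ⟨m, hm1, hm2⟩ := exists_between hlt
  set W := envelope fullChord f with hWdef
  have e1 : ∀ᶠ z in 𝓝 x, ∀ k, m < secondPartial φ k z := by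
    refine eventually_all.2 fun k => ((continuous_secondPartial hφ k).tendsto x).eventually_const_lt
      (hm2.trans_le (ciInf_le (Set.finite_range _).bddBelow k))
  obtain ⟨r, hr, H⟩ := Metric.eventually_nhds_iff_ball.1
    (e1.and (hmax.and (isOpen_openCube.mem_nhds hx)))
  -- The bending lowers second derivatives by `2 * η`, using up exactly the excess `m + 2`.
  set η := (m + 2) / 2 with hη
  have hη0 : 0 < η := by simp only [hη]; linarith
  -- Half the drop `η * (r / 2) ^ 2` which the bending produces at distance `r / 2`.
  set δ := η * r ^ 2 / 8 with hδ
  have hδ0 : 0 < δ := by positivity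
  set Ψ : (Fin n → ℝ) → ℝ := fun z =>
    φ z + sqSum z - η * sqSum (z - x) + (W x - φ x - sqSum x + δ) with hΨ
  have hcube : ∀ z ∈ Metric.ball x r, z ∈ cube n := fun z hz => openCube_subset_cube (H z hz).2.2
  have hxb : x ∈ Metric.ball x r := Metric.mem_ball_self hr
  have hmin := isMinorant_max (f := f) (Ψ := Ψ) hr (fun z hz => hf z (H z hz).2.2)
    (by
      have := hφ.continuous
      have := continuous_sqSum (n := n)
      fun_prop)
    (by
      intro z hz hzd
      have h1 := (H z hz).2.1
      simp only [hu z (hcube z hz), hu x (hcube x hxb)] at h1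
      have h2 : (r / 2) ^ 2 ≤ sqSum (z - x) := by
        refine le_trans ?_ (sq_norm_le_sqSum _)
        rw [← dist_eq_norm]
        gcongr
      have h3 := mul_le_mul_of_nonneg_left h2 hη0.le
      simp only [hΨ, hδ]
      nlinarith)
    (by
      intro z i s hs hzs
      have h1 := le_second_difference (m := m) hφ i z hs fun t ht => by
        refine ((H _ ?_).1 i).le
        rw [Metric.mem_ball]
        refine lt_of_le_of_lt (dist_triangle _ z _) ?_
        have : dist (z + t • Pi.single i (1 : ℝ)) z ≤ s := by
          rw [dist_eq_norm, add_sub_cancel_left, norm_smul, Pi.norm_single]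
          simpa using abs_le.2 ht
        linarith
      simp only [hΨ, add_sub_right_comm z _ x, sqSum_add]
      simp only [hη]
      nlinarith)
  have hle := hmin.le_envelope isChordSystem_fullChord (hcube x hxb)
  simp only [if_pos hxb] at hle
  have h1 := (le_max_right _ _).trans hle
  have h0 : sqSum (0 : Fin n → ℝ) = 0 := by simp [sqSum]
  simp only [hΨ, sub_self, h0] at h1
  linarith

/-- A solved point in the open cube makes every point of the cube solved. -/
lemma cube_subset_solved {z : Fin n → ℝ} (hz : z ∈ openCube n) (hf : z ∈ solved f) :
    cube n ⊆ solved f := fun x hx => by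
  have := piecewise_mem_solved (openCube_subset_cube hz) hx hf Finset.univ
    fun i _ => mem_openCube.1 hz i
  simpa using this

end

end AxisAligned

/-! ### Reachable positions and the law of one step. -/

namespace AxisAligned

noncomputable section

variable {n : ℕ}

/-! ### Positions and means of a jump -/

/-- The positions which a jump process started at `x` can reach. -/
def gridBox (ε : ℝ) (x : Fin n → ℝ) : Set (Fin n → ℝ) := Set.univ.pi fun i => grid ε (x i)

variable {ε : ℝ} {x : Fin n → ℝ}

lemma mem_gridBox {s : Fin n → ℝ} : s ∈ gridBox ε x ↔ ∀ i, s i ∈ grid ε (x i) := by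
  simp only [gridBox, Set.mem_univ_pi]

lemma finite_gridBox (hε : 0 < ε) (x : Fin n → ℝ) : (gridBox ε x).Finite :=
  Set.Finite.pi fun i => finite_grid hε (x i)

lemma gridBox_subset_cube : gridBox ε x ⊆ cube n := fun _ hs =>
  mem_cube.2 fun i => (mem_gridBox.1 hs i).1

lemma self_mem_gridBox (hx : x ∈ cube n) : x ∈ gridBox ε x :=
  mem_gridBox.2 fun i => self_mem_grid (mem_cube.1 hx i)

lemma update_mem_gridBox {s : Fin n → ℝ} (hs : s ∈ gridBox ε x) {i : Fin n} {t : ℝ}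
    (ht : t ∈ grid ε (x i)) : Function.update s i t ∈ gridBox ε x := by
  rw [mem_gridBox] at hs ⊢
  intro j
  rcases eq_or_ne j i with rfl | hj
  · simpa using ht
  · simpa [hj] using hs j

/-- The position after the `i`-th coordinate jumps to the lower end. -/
def jumpDown (ε : ℝ) (s : Fin n → ℝ) (i : Fin n) : Fin n → ℝ :=
  Function.update s i (lowerEnd ε (s i))

/-- The position after the `i`-th coordinate jumps to the upper end. -/
def jumpUp (ε : ℝ) (s : Fin n → ℝ) (i : Fin n) : Fin n → ℝ :=
  Function.update s i (upperEnd ε (s i))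

lemma jumpDown_mem_gridBox (hε : 0 < ε) (h1 : ε ≤ 1) {s : Fin n → ℝ} (hs : s ∈ gridBox ε x)
    {i : Fin n} (hi : s i ∈ Set.Ioo (-1 : ℝ) 1) : jumpDown ε s i ∈ gridBox ε x :=
  update_mem_gridBox hs (lowerEnd_mem_grid hε h1 (mem_gridBox.1 hs i) hi)

lemma jumpUp_mem_gridBox (hε : 0 < ε) (h1 : ε ≤ 1) {s : Fin n → ℝ} (hs : s ∈ gridBox ε x)
    {i : Fin n} (hi : s i ∈ Set.Ioo (-1 : ℝ) 1) : jumpUp ε s i ∈ gridBox ε x :=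
  update_mem_gridBox hs (upperEnd_mem_grid hε h1 (mem_gridBox.1 hs i) hi)

/-- The probability that the `i`-th coordinate jumps up. -/
def upProb (ε : ℝ) (s : Fin n → ℝ) (i : Fin n) : ℝ := (s i - lowerEnd ε (s i)) / (2 * ε)

lemma upProb_mem_Icc (hε : 0 < ε) {s : Fin n → ℝ} {i : Fin n}
    (hi : s i ∈ Set.Ioo (-1 : ℝ) 1) : upProb ε s i ∈ Set.Icc (0 : ℝ) 1 := by
  have h1 := lowerEnd_lt hε hi
  have h2 := lt_upperEnd hε hi
  have h3 := upperEnd_sub_lowerEnd ε (s i)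
  rw [upProb]
  refine ⟨div_nonneg (by linarith) (by positivity), ?_⟩
  rw [div_le_one (by positivity)]
  linarith

/-- The mean of `g` after a jump of the `i`-th coordinate. -/
def jumpMean (ε : ℝ) (g : (Fin n → ℝ) → ℝ) (s : Fin n → ℝ) (i : Fin n) : ℝ :=
  g (jumpDown ε s i) + (g (jumpUp ε s i) - g (jumpDown ε s i)) * upProb ε s i

lemma belowChord_iff_le_jumpMean (hε : 0 < ε) (g : (Fin n → ℝ) → ℝ) (s : Fin n → ℝ)
    (i : Fin n) : BelowChord g s i (lowerEnd ε (s i)) (upperEnd ε (s i)) ↔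
      g s ≤ jumpMean ε g s i := by
  have h := upperEnd_sub_lowerEnd ε (s i)
  have e : jumpMean ε g s i = ((upperEnd ε (s i) - s i) * g (jumpDown ε s i) +
      (s i - lowerEnd ε (s i)) * g (jumpUp ε s i)) / (2 * ε) := by
    rw [eq_div_iff (by positivity), jumpMean, upProb, add_mul, mul_assoc,
      div_mul_cancel₀ _ (by positivity : (2 * ε) ≠ 0), ← h]
    ring
  rw [BelowChord, e, le_div_iff₀' (by positivity), h]
  rfl

/-- The added term is the variance of the jump; it is the drift that forces the process to stop. -/
lemma jumpMean_sqSum (hε : 0 < ε) (s : Fin n → ℝ) (i : Fin n) :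
    jumpMean ε sqSum s i =
      sqSum s + (upperEnd ε (s i) - s i) * (s i - lowerEnd ε (s i)) := by
  have h := upperEnd_sub_lowerEnd ε (s i)
  have hb : upperEnd ε (s i) = lowerEnd ε (s i) + 2 * ε := by linarith
  simp only [jumpMean, jumpUp, jumpDown, sqSum_update, upProb, hb]
  field_simp
  ring

lemma jumpMean_eval (hε : 0 < ε) (s : Fin n → ℝ) (i j : Fin n) :
    jumpMean ε (fun s => s j) s i = s j := by
  have h := upperEnd_sub_lowerEnd ε (s i)
  have hb : upperEnd ε (s i) = lowerEnd ε (s i) + 2 * ε := by linarith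
  rcases eq_or_ne j i with rfl | hj
  · simp only [jumpMean, jumpUp, jumpDown, upProb, hb, Function.update_self]
    field_simp
    ring
  · simp [jumpMean, jumpUp, jumpDown, hj]

/-- A clipped jump starting near a face can have arbitrarily small variance, so the uniform bound
comes from the finiteness of the set of reachable positions. -/
lemma exists_variance_lower_bound (hε : 0 < ε) (x : Fin n → ℝ) :
    ∃ c > 0, ∀ s ∈ gridBox ε x, ∀ i, s i ∈ Set.Ioo (-1 : ℝ) 1 →
      c ≤ (upperEnd ε (s i) - s i) * (s i - lowerEnd ε (s i)) := by
  set v : (Fin n → ℝ) × Fin n → ℝ := fun p =>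
    (upperEnd ε (p.1 p.2) - p.1 p.2) * (p.1 p.2 - lowerEnd ε (p.1 p.2)) with hv
  set A : Set ((Fin n → ℝ) × Fin n) :=
    {p | p.1 ∈ gridBox ε x ∧ p.1 p.2 ∈ Set.Ioo (-1 : ℝ) 1} with hA
  have hAf : A.Finite := ((finite_gridBox hε x).prod Set.finite_univ).subset
    fun p hp => ⟨hp.1, trivial⟩
  rcases A.eq_empty_or_nonempty with h | h
  · refine ⟨1, one_pos, fun s hs i hi => ?_⟩
    have : (s, i) ∈ A := ⟨hs, hi⟩
    simp [h] at this
  · obtain ⟨p, hp, hmin⟩ := Set.exists_min_image A v hAf h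
    exact ⟨v p, mul_pos (sub_pos.2 (lt_upperEnd hε hp.2)) (sub_pos.2 (lowerEnd_lt hε hp.2)),
      fun s hs i hi => hmin (s, i) ⟨hs, hi⟩⟩

lemma measurable_lowerEnd (ε : ℝ) : Measurable (lowerEnd ε) := by
  unfold lowerEnd
  exact Measurable.ite (measurableSet_lt measurable_const (by fun_prop)) measurable_const
    (Measurable.ite (measurableSet_lt (by fun_prop) measurable_const) measurable_const
      (by fun_prop))

lemma measurable_upperEnd (ε : ℝ) : Measurable (upperEnd ε) := by
  unfold upperEnd
  exact Measurable.ite (measurableSet_lt measurable_const (by fun_prop)) measurable_const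
    (Measurable.ite (measurableSet_lt (by fun_prop) measurable_const) measurable_const
      (by fun_prop))

lemma measurable_update_fst {e : ℝ → ℝ} (he : Measurable e) :
    Measurable fun p : (Fin n → ℝ) × Fin n => Function.update p.1 p.2 (e (p.1 p.2)) := by
  refine measurable_from_prod_countable_left fun i => measurable_pi_lambda _ fun j => ?_
  rcases eq_or_ne j i with rfl | hj
  · simpa [Function.comp_def] using he.comp (measurable_pi_apply j)
  · simpa [hj] using measurable_pi_apply j

lemma measurable_jumpDown (ε : ℝ) :
    Measurable fun p : (Fin n → ℝ) × Fin n => jumpDown ε p.1 p.2 :=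
  measurable_update_fst (measurable_lowerEnd ε)

lemma measurable_jumpUp (ε : ℝ) :
    Measurable fun p : (Fin n → ℝ) × Fin n => jumpUp ε p.1 p.2 :=
  measurable_update_fst (measurable_upperEnd ε)

lemma measurable_eval_fst : Measurable fun p : (Fin n → ℝ) × Fin n => p.1 p.2 :=
  measurable_from_prod_countable_left fun i => measurable_pi_apply i

lemma measurable_upProb (ε : ℝ) :
    Measurable fun p : (Fin n → ℝ) × Fin n => upProb ε p.1 p.2 :=
  (measurable_eval_fst.sub ((measurable_lowerEnd ε).comp measurable_eval_fst)).div_const _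

lemma measurableSet_vertices : MeasurableSet (vertices n) :=
  MeasurableSet.univ_pi fun _ => (Set.toFinite _).measurableSet

/-! ### Functions of a random point of a finite set -/

/-- Measurability of the jump envelope is not needed: only its values on the finite set of reachable
positions enter. -/
lemma measurable_indicator_finite {B : Set (Fin n → ℝ)} (hB : B.Finite) (g : (Fin n → ℝ) → ℝ) :
    Measurable (B.indicator g) := by
  refine measurable_const.measurable_of_countable_ne (f := fun _ => (0 : ℝ))
    (hB.countable.mono fun s hs => ?_)
  by_contra h
  exact hs (Set.indicator_of_notMem h g).symm

lemma exists_bound_indicator_finite {B : Set (Fin n → ℝ)} (hB : B.Finite)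
    (g : (Fin n → ℝ) → ℝ) : ∃ C, ∀ s, ‖B.indicator g s‖ ≤ C := by
  obtain ⟨C, hC⟩ := (hB.image fun s => ‖g s‖).bddAbove
  refine ⟨max C 0, fun s => ?_⟩
  by_cases hs : s ∈ B
  · rw [Set.indicator_of_mem hs]
    exact (hC ⟨s, hs, rfl⟩).trans (le_max_left _ _)
  · rw [Set.indicator_of_notMem hs, norm_zero]
    exact le_max_right _ _

variable {Ω : Type} [mΩ : MeasurableSpace Ω] {μ : Measure Ω}

lemma ae_eq_indicator_comp {B : Set (Fin n → ℝ)} {Z : Ω → Fin n → ℝ} (h : ∀ᵐ ω ∂μ, Z ω ∈ B)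
    (g : (Fin n → ℝ) → ℝ) : (fun ω => g (Z ω)) =ᵐ[μ] fun ω => B.indicator g (Z ω) :=
  h.mono fun _ hω => (Set.indicator_of_mem hω g).symm

lemma integrable_comp_of_finite [IsProbabilityMeasure μ] {B : Set (Fin n → ℝ)} (hB : B.Finite) {Z : Ω → Fin n → ℝ}
    (hZ : AEMeasurable Z μ) (h : ∀ᵐ ω ∂μ, Z ω ∈ B) (g : (Fin n → ℝ) → ℝ) :
    Integrable (fun ω => g (Z ω)) μ := by
  obtain ⟨C, hC⟩ := exists_bound_indicator_finite hB g
  refine Integrable.congr (Integrable.of_bound (C := C) ?_ ?_) (ae_eq_indicator_comp h g).symm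
  · exact ((measurable_indicator_finite hB g).comp_aemeasurable hZ).aestronglyMeasurable
  · exact Eventually.of_forall fun ω => hC _

/-! ### One step of a jump process -/

variable {ℱ : Filtration ℕ mΩ} {X : ℕ → Ω → Fin n → ℝ} {d : ℕ → Ω → Fin n}

namespace IsJumpProcess

lemma measurable (hX : IsJumpProcess μ ℱ ε x X d) (t : ℕ) : Measurable (X t) :=
  (hX.adapted t).mono (ℱ.le t) le_rfl

lemma measurable_pair (hX : IsJumpProcess μ ℱ ε x X d) (t : ℕ) :
    Measurable[ℱ t] fun ω => (X t ω, d t ω) :=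
  (hX.adapted t).prodMk (hX.direction_adapted t)

/-- A step from a position which is not a vertex leads to one of the two ends. -/
lemma step (hX : IsJumpProcess μ ℱ ε x X d) (t : ℕ) : ∀ᵐ ω ∂μ, X t ω ∉ vertices n →
    X (t + 1) ω = jumpDown ε (X t ω) (d t ω) ∨ X (t + 1) ω = jumpUp ε (X t ω) (d t ω) := by
  filter_upwards [hX.fixed t, hX.jump t] with ω h1 h2 hv
  have key : ∀ e : ℝ, X (t + 1) ω (d t ω) = e →
      X (t + 1) ω = Function.update (X t ω) (d t ω) e := by
    intro e he
    ext j
    rcases eq_or_ne j (d t ω) with rfl | hj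
    · simpa using he
    · simpa [hj] using h1 hv j hj
  exact (h2 hv).imp (key _) (key _)

lemma ae_mem_gridBox (hX : IsJumpProcess μ ℱ ε x X d) (hε : 0 < ε) (h1 : ε ≤ 1)
    (hx : x ∈ cube n) : ∀ᵐ ω ∂μ, ∀ t, X t ω ∈ gridBox ε x := by
  refine ae_all_iff.2 fun t => ?_
  induction t with
  | zero => filter_upwards [hX.start] with ω hω; rw [hω]; exact self_mem_gridBox hx
  | succ t ih =>
    filter_upwards [ih, hX.stay t, hX.step t, hX.direction_mem t] with ω h2 h3 h4 h5
    by_cases hv : X t ω ∈ vertices n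
    · rw [h3 hv]; exact h2
    · rcases h4 hv with h | h <;> rw [h]
      · exact jumpDown_mem_gridBox hε h1 h2 (h5 hv)
      · exact jumpUp_mem_gridBox hε h1 h2 (h5 hv)

/-- The mean of a bounded measurable function after one step, on an event known before it. -/
lemma setIntegral_succ_of_bound [IsProbabilityMeasure μ] (hX : IsJumpProcess μ ℱ ε x X d) (hε : 0 < ε)
    {g : (Fin n → ℝ) → ℝ} (hg : Measurable g) {C : ℝ} (hC : ∀ s, ‖g s‖ ≤ C) (t : ℕ) {A : Set Ω}
    (hA : MeasurableSet[ℱ t] A) (hAv : ∀ ω ∈ A, X t ω ∉ vertices n) :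
    ∫ ω in A, g (X (t + 1) ω) ∂μ = ∫ ω in A, jumpMean ε g (X t ω) (d t ω) ∂μ := by
  have hle := ℱ.le t
  set E : Set Ω := {ω | X (t + 1) ω (d t ω) = upperEnd ε (X t ω (d t ω))} with hE
  have hd : Measurable (d t) := (hX.direction_adapted t).mono hle le_rfl
  have hEm : MeasurableSet E := measurableSet_eq_fun
    (measurable_eval_fst.comp ((hX.measurable (t + 1)).prodMk hd))
    ((measurable_upperEnd ε).comp (measurable_eval_fst.comp ((hX.measurable t).prodMk hd)))
  set lo : Ω → ℝ := fun ω => g (jumpDown ε (X t ω) (d t ω)) with hlo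
  set up : Ω → ℝ := fun ω => g (jumpUp ε (X t ω) (d t ω)) with hup
  have hlom : Measurable[ℱ t] lo := hg.comp ((measurable_jumpDown ε).comp (hX.measurable_pair t))
  have hupm : Measurable[ℱ t] up := hg.comp ((measurable_jumpUp ε).comp (hX.measurable_pair t))
  have hdm : StronglyMeasurable[ℱ t] (up - lo) := (hupm.sub hlom).stronglyMeasurable
  set ind : Ω → ℝ := E.indicator fun _ => (1 : ℝ) with hind
  have hindi : Integrable ind μ := (integrable_const 1).indicator hEm
  have hloi : Integrable lo μ := Integrable.of_bound
    (hlom.mono hle le_rfl).aestronglyMeasurable C (Eventually.of_forall fun ω => hC _)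
  have hupi : Integrable up μ := Integrable.of_bound
    (hupm.mono hle le_rfl).aestronglyMeasurable C (Eventually.of_forall fun ω => hC _)
  have hmul : Integrable ((up - lo) * ind) μ := by
    refine Integrable.bdd_mul (c := C + C) hindi
      (hdm.mono hle).aestronglyMeasurable (Eventually.of_forall fun ω => ?_)
    exact (norm_sub_le _ _).trans (add_le_add (hC _) (hC _))
  -- Both possible outcomes are known at time `t`; only the indicator of the upward jump is
  -- averaged, and its conditional mean is prescribed.
  have hpull : μ[(up - lo) * ind | ℱ t] =ᵐ[μ] (up - lo) * μ[ind | ℱ t] :=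
    condExp_mul_of_stronglyMeasurable_left hdm hmul hindi
  have hAm := hle A hA
  have hleft : ∫ ω in A, g (X (t + 1) ω) ∂μ = ∫ ω in A, (lo + (up - lo) * ind) ω ∂μ := by
    refine setIntegral_congr_ae hAm ?_
    filter_upwards [hX.step t, hX.direction_mem t] with ω h2 h3 hωA
    have hv := hAv ω hωA
    have hlt := (lowerEnd_lt hε (h3 hv)).trans (lt_upperEnd hε (h3 hv))
    simp only [Pi.add_apply, Pi.mul_apply, Pi.sub_apply, hlo, hup, hind]
    rcases h2 hv with h | h
    · have : ω ∉ E := by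
        simp only [hE, Set.mem_ofPred_eq, h, jumpDown, Function.update_self]
        exact hlt.ne
      rw [Set.indicator_of_notMem this, h]; ring
    · have : ω ∈ E := by
        simp only [hE, Set.mem_ofPred_eq, h, jumpUp, Function.update_self]
      rw [Set.indicator_of_mem this, h]; ring
  have hright : ∫ ω in A, ((up - lo) * ind) ω ∂μ =
      ∫ ω in A, (up ω - lo ω) * upProb ε (X t ω) (d t ω) ∂μ := by
    rw [← setIntegral_condExp hle hmul hA]
    refine setIntegral_congr_ae hAm ?_
    filter_upwards [hpull, hX.law t] with ω h2 h3 hωA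
    rw [h2, Pi.mul_apply, Pi.sub_apply, h3 (hAv ω hωA)]
    rfl
  have hupb : Integrable (fun ω => (up ω - lo ω) * upProb ε (X t ω) (d t ω))
      (μ.restrict A) := by
    have : Integrable (fun ω => ((up - lo) * μ[ind | ℱ t]) ω) (μ.restrict A) :=
      (integrable_condExp.congr hpull).restrict
    refine this.congr ?_
    rw [EventuallyEq, ae_restrict_iff' hAm]
    filter_upwards [hX.law t] with ω h3 hωA
    rw [Pi.mul_apply, Pi.sub_apply, h3 (hAv ω hωA)]
    rfl
  rw [hleft]
  simp only [Pi.add_apply]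
  rw [integral_add hloi.restrict hmul.restrict, hright, ← integral_add hloi.restrict hupb]
  rfl

end IsJumpProcess

end

end AxisAligned

/-! ### Optional stopping and the lower bound for the cost. -/

namespace AxisAligned

noncomputable section

variable {n : ℕ} {ε : ℝ} {x : Fin n → ℝ} {f : (Fin n → ℤˣ) → ℤˣ}
  {Ω : Type} {X : ℕ → Ω → Fin n → ℝ}

/-! ### The stopped process -/

lemma stopTime_le_iff {t : ℕ} {ω : Ω} :
    stopTime f X ω ≤ t ↔ ∃ s ≤ t, X s ω ∈ solved f := by
  simpa [stopTime, solved] using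
    hittingAfter_le_iff (u := X) (s := {z | harmonicExt f z ∈ ({-1, 1} : Set ℝ)}) (n := 0)
      (i := t) (ω := ω)

/-- The process, stopped when the function is determined. -/
def stoppedAt (f : (Fin n → ℤˣ) → ℤˣ) (X : ℕ → Ω → Fin n → ℝ) (t : ℕ) : Ω → Fin n → ℝ :=
  stoppedProcess X (stopTime f X) t

/-- The position at the stopping time. -/
def finalPos (f : (Fin n → ℤˣ) → ℤˣ) (X : ℕ → Ω → Fin n → ℝ) : Ω → Fin n → ℝ :=
  stoppedValue X (stopTime f X)

/-- The event that the process has not been stopped up to time `t`. -/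
def alive (f : (Fin n → ℤˣ) → ℤˣ) (X : ℕ → Ω → Fin n → ℝ) (t : ℕ) : Set Ω :=
  {ω | (t : WithTop ℕ) < stopTime f X ω}

lemma notMem_solved_of_alive {t : ℕ} {ω : Ω} (h : ω ∈ alive f X t) : X t ω ∉ solved f :=
  fun hs => not_le.2 h (stopTime_le_iff.2 ⟨t, le_rfl, hs⟩)

lemma alive_antitone : Antitone (alive f X) := fun _ _ hst _ hω =>
  lt_of_le_of_lt (WithTop.coe_le_coe.2 hst) hω

lemma stoppedAt_of_alive {t : ℕ} {ω : Ω} (h : ω ∈ alive f X t) :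
    stoppedAt f X t ω = X t ω := stoppedProcess_eq_of_le (le_of_lt h)

lemma stoppedAt_succ_of_alive {t : ℕ} {ω : Ω} (h : ω ∈ alive f X t) :
    stoppedAt f X (t + 1) ω = X (t + 1) ω :=
  stoppedProcess_eq_of_le (by
    have h' : (t : WithTop ℕ) < stopTime f X ω := h
    by_cases ht : stopTime f X ω = ⊤
    · rw [ht]; exact le_top
    · obtain ⟨T, hT⟩ := WithTop.ne_top_iff_exists.1 ht
      rw [← hT] at h' ⊢
      exact WithTop.coe_le_coe.2 (Nat.succ_le_of_lt (WithTop.coe_lt_coe.1 h')))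

lemma stoppedAt_of_notMem_alive {t : ℕ} {ω : Ω} (h : ω ∉ alive f X t) :
    stoppedAt f X t ω = finalPos f X ω := stoppedProcess_eq_of_ge (not_lt.1 h)

lemma stoppedAt_zero (ω : Ω) : stoppedAt f X 0 ω = X 0 ω :=
  stoppedProcess_eq_of_le bot_le

variable [mΩ : MeasurableSpace Ω] {μ : Measure Ω} {ℱ : Filtration ℕ mΩ} {d : ℕ → Ω → Fin n}

namespace IsJumpProcess

lemma isStoppingTime (hX : IsJumpProcess μ ℱ ε x X d) : IsStoppingTime ℱ (stopTime f X) :=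
  Adapted.isStoppingTime_hittingAfter hX.adapted (measurableSet_solved f)

lemma measurableSet_alive (hX : IsJumpProcess μ ℱ ε x X d) (t : ℕ) :
    MeasurableSet[ℱ t] (alive f X t) := by
  have := (hX.isStoppingTime (f := f) t).compl
  convert this using 1
  ext ω; simp [alive]

lemma measurable_stoppedAt (hX : IsJumpProcess μ ℱ ε x X d) (t : ℕ) :
    Measurable (stoppedAt f X t) :=
  ((StronglyAdapted.stronglyMeasurable_stoppedProcess_of_discrete
    (fun t => (hX.adapted t).stronglyMeasurable) hX.isStoppingTime t)).measurable

lemma ae_stoppedAt_mem (hX : IsJumpProcess μ ℱ ε x X d) (hε : 0 < ε) (h1 : ε ≤ 1)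
    (hx : x ∈ cube n) : ∀ᵐ ω ∂μ, ∀ t, stoppedAt f X t ω ∈ gridBox ε x :=
  (hX.ae_mem_gridBox hε h1 hx).mono fun _ hω _ => hω _

lemma integrable_stoppedAt [IsProbabilityMeasure μ] (hX : IsJumpProcess μ ℱ ε x X d)
    (hε : 0 < ε) (h1 : ε ≤ 1) (hx : x ∈ cube n) (g : (Fin n → ℝ) → ℝ) (t : ℕ) :
    Integrable (fun ω => g (stoppedAt f X t ω)) μ :=
  integrable_comp_of_finite (finite_gridBox hε x) (hX.measurable_stoppedAt t).aemeasurable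
    ((hX.ae_stoppedAt_mem hε h1 hx).mono fun _ h => h t) g

/-- On the event that the process is alive, the chosen coordinate is interior. -/
lemma ae_alive (hX : IsJumpProcess μ ℱ ε x X d) (t : ℕ) : ∀ᵐ ω ∂μ, ω ∈ alive f X t →
    X t ω ∉ solved f ∧ X t ω (d t ω) ∈ Set.Ioo (-1 : ℝ) 1 := by
  filter_upwards [hX.direction_mem t] with ω h hω
  have hs := notMem_solved_of_alive hω
  exact ⟨hs, h fun hv => hs (vertices_subset_solved f hv)⟩

lemma setIntegral_alive_succ [IsProbabilityMeasure μ] (hX : IsJumpProcess μ ℱ ε x X d)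
    (hε : 0 < ε) (h1 : ε ≤ 1) (hx : x ∈ cube n) (g : (Fin n → ℝ) → ℝ) (t : ℕ) :
    ∫ ω in alive f X t, g (X (t + 1) ω) ∂μ =
      ∫ ω in alive f X t, jumpMean ε g (X t ω) (d t ω) ∂μ := by
  have hB := finite_gridBox hε x
  have hA := hX.measurableSet_alive (f := f) t
  obtain ⟨C, hC⟩ := exists_bound_indicator_finite hB g
  have key := hX.setIntegral_succ_of_bound hε (measurable_indicator_finite hB g) hC t hA
    fun ω hω hv => notMem_solved_of_alive hω (vertices_subset_solved f hv)
  have hmem := hX.ae_mem_gridBox hε h1 hx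
  rw [setIntegral_congr_ae (ℱ.le t _ hA) (g := fun ω => (gridBox ε x).indicator g (X (t + 1) ω))
    (by filter_upwards [hmem] with ω h _; exact (Set.indicator_of_mem (h _) g).symm), key]
  refine setIntegral_congr_ae (ℱ.le t _ hA) ?_
  filter_upwards [hmem, hX.ae_alive t] with ω h h2 hω
  have hi := (h2 hω).2
  simp only [jumpMean, Set.indicator_of_mem (jumpDown_mem_gridBox hε h1 (h t) hi),
    Set.indicator_of_mem (jumpUp_mem_gridBox hε h1 (h t) hi)]

lemma integrableOn_jumpMean [IsProbabilityMeasure μ] (hX : IsJumpProcess μ ℱ ε x X d)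
    (hε : 0 < ε) (h1 : ε ≤ 1) (hx : x ∈ cube n) (g : (Fin n → ℝ) → ℝ) (t : ℕ) :
    IntegrableOn (fun ω => jumpMean ε g (X t ω) (d t ω)) (alive f X t) μ := by
  have hB := finite_gridBox hε x
  have hA := ℱ.le t _ (hX.measurableSet_alive (f := f) t)
  obtain ⟨C, hC⟩ := exists_bound_indicator_finite hB g
  set g' := (gridBox ε x).indicator g with hg'
  have hg'm : Measurable g' := measurable_indicator_finite hB g
  have hp := (hX.measurable_pair t).mono (ℱ.le t) le_rfl
  have hm : Measurable fun ω => jumpMean ε g' (X t ω) (d t ω) := by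
    have h2 := hg'm.comp ((measurable_jumpDown ε).comp hp)
    have h3 := hg'm.comp ((measurable_jumpUp ε).comp hp)
    exact h2.add ((h3.sub h2).mul ((measurable_upProb ε).comp hp))
  have hC0 : 0 ≤ C := (norm_nonneg _).trans (hC 0)
  refine Integrable.congr (f := fun ω => jumpMean ε g' (X t ω) (d t ω))
    (Integrable.of_bound hm.aestronglyMeasurable (C + (C + C) * 1) ?_) ?_
  · rw [ae_restrict_iff' hA]
    filter_upwards [hX.ae_alive t] with ω h2 hω
    have hi := (h2 hω).2
    refine (norm_add_le _ _).trans (add_le_add (hC _) ?_)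
    rw [norm_mul]
    refine mul_le_mul ((norm_sub_le _ _).trans (add_le_add (hC _) (hC _))) ?_ (norm_nonneg _)
      (by linarith)
    have := upProb_mem_Icc hε hi
    rw [Real.norm_eq_abs, abs_of_nonneg this.1]
    exact this.2
  · rw [EventuallyEq, ae_restrict_iff' hA]
    filter_upwards [hX.ae_mem_gridBox hε h1 hx, hX.ae_alive t] with ω h h2 hω
    have hi := (h2 hω).2
    simp only [jumpMean, hg', Set.indicator_of_mem (jumpDown_mem_gridBox hε h1 (h t) hi),
      Set.indicator_of_mem (jumpUp_mem_gridBox hε h1 (h t) hi)]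

/-- The mean of a function of the stopped process changes in one step by the drift on the event
that the process is alive. -/
lemma integral_stoppedAt_succ [IsProbabilityMeasure μ] (hX : IsJumpProcess μ ℱ ε x X d)
    (hε : 0 < ε) (h1 : ε ≤ 1) (hx : x ∈ cube n) (g : (Fin n → ℝ) → ℝ) (t : ℕ) :
    ∫ ω, g (stoppedAt f X (t + 1) ω) ∂μ = ∫ ω, g (stoppedAt f X t ω) ∂μ +
      ∫ ω in alive f X t, (jumpMean ε g (X t ω) (d t ω) - g (X t ω)) ∂μ := by
  have hA := ℱ.le t _ (hX.measurableSet_alive (f := f) t)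
  have hXi : Integrable (fun ω => g (X t ω)) μ :=
    integrable_comp_of_finite (finite_gridBox hε x) (hX.measurable t).aemeasurable
      ((hX.ae_mem_gridBox hε h1 hx).mono fun _ h => h t) g
  rw [integral_sub (hX.integrableOn_jumpMean hε h1 hx g t) hXi.integrableOn,
    ← hX.setIntegral_alive_succ hε h1 hx g t,
    ← integral_add_compl hA (hX.integrable_stoppedAt hε h1 hx g (t + 1)),
    ← integral_add_compl hA (hX.integrable_stoppedAt hε h1 hx g t),
    setIntegral_congr_fun hA (g := fun ω => g (X (t + 1) ω))
      (fun ω hω => by simp only [stoppedAt_succ_of_alive hω]),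
    setIntegral_congr_fun hA (f := fun ω => g (stoppedAt f X t ω)) (g := fun ω => g (X t ω))
      (fun ω hω => by simp only [stoppedAt_of_alive hω]),
    -- Off the event of being alive the stopped process no longer moves, so these contributions
    -- cancel.
    setIntegral_congr_fun hA.compl (g := fun ω => g (stoppedAt f X t ω)) (fun ω hω => by
      have hω' : ω ∉ alive f X (t + 1) := fun h => hω (alive_antitone (Nat.le_succ t) h)
      simp only [stoppedAt_of_notMem_alive hω', stoppedAt_of_notMem_alive hω])]
  ring

lemma integral_stoppedAt_zero [IsProbabilityMeasure μ] (hX : IsJumpProcess μ ℱ ε x X d)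
    (g : (Fin n → ℝ) → ℝ) : ∫ ω, g (stoppedAt f X 0 ω) ∂μ = g x := by
  rw [integral_congr_ae (g := fun _ => g x)
    (hX.start.mono fun ω h => by simp only [stoppedAt_zero, h])]
  simp

/-- The process is stopped almost surely. -/
lemma ae_stopTime_ne_top [IsProbabilityMeasure μ] (hX : IsJumpProcess μ ℱ ε x X d)
    (hε : 0 < ε) (h1 : ε ≤ 1) (hx : x ∈ cube n) : ∀ᵐ ω ∂μ, stopTime f X ω ≠ ⊤ := by
  obtain ⟨c, hc, hcb⟩ := exists_variance_lower_bound hε x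
  -- Each step taken while alive adds at least `c` to the mean of `|X|²`, which never exceeds `n`.
  -- Hence the probability of being alive at time `T` is at most `n / (c * T)`.
  have hstep : ∀ t, ∫ ω, sqSum (stoppedAt f X t ω) ∂μ + c * μ.real (alive f X t) ≤
      ∫ ω, sqSum (stoppedAt f X (t + 1) ω) ∂μ := fun t => by
    rw [hX.integral_stoppedAt_succ hε h1 hx]
    have hA := ℱ.le t _ (hX.measurableSet_alive (f := f) t)
    have hXi : Integrable (fun ω => sqSum (X t ω)) μ :=
      integrable_comp_of_finite (finite_gridBox hε x) (hX.measurable t).aemeasurable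
        ((hX.ae_mem_gridBox hε h1 hx).mono fun _ h => h t) sqSum
    have : ∫ _ in alive f X t, c ∂μ ≤
        ∫ ω in alive f X t, (jumpMean ε sqSum (X t ω) (d t ω) - sqSum (X t ω)) ∂μ := by
      refine setIntegral_mono_on_ae (integrable_const c).integrableOn
        ((hX.integrableOn_jumpMean hε h1 hx sqSum t).sub hXi.integrableOn) hA ?_
      filter_upwards [hX.ae_mem_gridBox hε h1 hx, hX.ae_alive t] with ω h h2 hω
      rw [jumpMean_sqSum hε]
      linarith [hcb _ (h t) _ (h2 hω).2]
    rw [setIntegral_const, smul_eq_mul] at this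
    linarith
  have hsum : ∀ T : ℕ, sqSum x + T * (c * μ.real (alive f X T)) ≤
      ∫ ω, sqSum (stoppedAt f X T ω) ∂μ := by
    intro T
    have : ∀ k ≤ T, sqSum x + k * (c * μ.real (alive f X T)) ≤
        ∫ ω, sqSum (stoppedAt f X k ω) ∂μ := by
      intro k
      induction k with
      | zero => intro _; simp [hX.integral_stoppedAt_zero]
      | succ k ih =>
        intro hk
        have h2 := ih (by omega)
        have h3 := hstep k
        have h4 : μ.real (alive f X T) ≤ μ.real (alive f X k) :=
          measureReal_mono (alive_antitone (by omega))
        have h5 := mul_le_mul_of_nonneg_left h4 hc.le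
        push_cast
        linarith
    exact this T le_rfl
  have hbd : ∀ T : ℕ, ∫ ω, sqSum (stoppedAt f X T ω) ∂μ ≤ n := fun T => by
    have := integral_mono_ae (hX.integrable_stoppedAt (f := f) hε h1 hx sqSum T)
      (integrable_const (n : ℝ)) ((hX.ae_stoppedAt_mem hε h1 hx).mono fun ω h =>
        sqSum_le (gridBox_subset_cube (h T)))
    simpa using this
  have hzero : μ.real {ω | stopTime f X ω = ⊤} = 0 := by
    refine le_antisymm (le_of_forall_pos_le_add fun δ hδ => ?_) measureReal_nonneg
    obtain ⟨T, hT⟩ := exists_nat_gt (n / (c * δ))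
    rw [div_lt_iff₀ (by positivity)] at hT
    have h2 : μ.real {ω | stopTime f X ω = ⊤} ≤ μ.real (alive f X T) :=
      measureReal_mono fun ω hω => by
        change (T : WithTop ℕ) < stopTime f X ω
        rw [show stopTime f X ω = ⊤ from hω]
        exact WithTop.coe_lt_top T
    have h3 := (hsum T).trans (hbd T)
    have h4 := sqSum_nonneg x
    by_contra! h5
    have h6 : δ ≤ μ.real (alive f X T) := by linarith
    have h7 := mul_le_mul_of_nonneg_left h6 (by positivity : 0 ≤ T * c)
    linarith
  rw [measureReal_eq_zero_iff] at hzero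
  rw [ae_iff]
  simpa using hzero

lemma ae_eventually_stoppedAt_eq [IsProbabilityMeasure μ] (hX : IsJumpProcess μ ℱ ε x X d)
    (hε : 0 < ε) (h1 : ε ≤ 1) (hx : x ∈ cube n) :
    ∀ᵐ ω ∂μ, ∀ᶠ t in atTop, stoppedAt f X t ω = finalPos f X ω := by
  filter_upwards [hX.ae_stopTime_ne_top (f := f) hε h1 hx] with ω hω
  obtain ⟨T, hT⟩ := WithTop.ne_top_iff_exists.1 hω
  filter_upwards [eventually_ge_atTop T] with t ht
  refine stoppedAt_of_notMem_alive fun h => ?_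
  have h' : (t : WithTop ℕ) < stopTime f X ω := h
  rw [← hT] at h'
  exact absurd ht (not_le.2 (WithTop.coe_lt_coe.1 h'))

lemma ae_finalPos_mem [IsProbabilityMeasure μ] (hX : IsJumpProcess μ ℱ ε x X d)
    (hε : 0 < ε) (h1 : ε ≤ 1) (hx : x ∈ cube n) :
    ∀ᵐ ω ∂μ, finalPos f X ω ∈ gridBox ε x ∧ finalPos f X ω ∈ solved f := by
  filter_upwards [hX.ae_mem_gridBox hε h1 hx, hX.ae_stopTime_ne_top (f := f) hε h1 hx]
    with ω h2 h3
  exact ⟨h2 _, hittingAfter_mem_set_of_ne_top h3⟩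

lemma aemeasurable_finalPos [IsProbabilityMeasure μ] (hX : IsJumpProcess μ ℱ ε x X d)
    (hε : 0 < ε) (h1 : ε ≤ 1) (hx : x ∈ cube n) : AEMeasurable (finalPos f X) μ :=
  aemeasurable_of_tendsto_metrizable_ae atTop
    (fun t => (hX.measurable_stoppedAt (f := f) t).aemeasurable)
    ((hX.ae_eventually_stoppedAt_eq hε h1 hx).mono fun _ h =>
      tendsto_const_nhds.congr' (h.mono fun _ ht => ht.symm))

lemma integrable_finalPos [IsProbabilityMeasure μ] (hX : IsJumpProcess μ ℱ ε x X d)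
    (hε : 0 < ε) (h1 : ε ≤ 1) (hx : x ∈ cube n) (g : (Fin n → ℝ) → ℝ) :
    Integrable (fun ω => g (finalPos f X ω)) μ :=
  integrable_comp_of_finite (finite_gridBox hε x) (hX.aemeasurable_finalPos hε h1 hx)
    ((hX.ae_finalPos_mem (f := f) hε h1 hx).mono fun _ h => h.1) g

lemma tendsto_integral_stoppedAt [IsProbabilityMeasure μ] (hX : IsJumpProcess μ ℱ ε x X d)
    (hε : 0 < ε) (h1 : ε ≤ 1) (hx : x ∈ cube n) (g : (Fin n → ℝ) → ℝ) :
    Tendsto (fun t => ∫ ω, g (stoppedAt f X t ω) ∂μ) atTop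
      (𝓝 (∫ ω, g (finalPos f X ω) ∂μ)) := by
  obtain ⟨C, hC⟩ := exists_bound_indicator_finite (finite_gridBox hε x) g
  refine tendsto_integral_of_dominated_convergence (fun _ => C)
    (fun t => (hX.integrable_stoppedAt hε h1 hx g t).aestronglyMeasurable)
    (integrable_const C) (fun t => ?_) ?_
  · filter_upwards [hX.ae_stoppedAt_mem (f := f) hε h1 hx] with ω h
    have := hC (stoppedAt f X t ω)
    rwa [Set.indicator_of_mem (h t)] at this
  · filter_upwards [hX.ae_eventually_stoppedAt_eq (f := f) hε h1 hx] with ω h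
    exact tendsto_const_nhds.congr' (h.mono fun t ht => by simp only [ht])

/-- Optional stopping for submartingales. -/
lemma le_integral_finalPos [IsProbabilityMeasure μ] (hX : IsJumpProcess μ ℱ ε x X d)
    (hε : 0 < ε) (h1 : ε ≤ 1) (hx : x ∈ cube n) {g : (Fin n → ℝ) → ℝ}
    (hg : ∀ t, ∀ᵐ ω ∂μ, ω ∈ alive f X t → g (X t ω) ≤ jumpMean ε g (X t ω) (d t ω)) :
    g x ≤ ∫ ω, g (finalPos f X ω) ∂μ := by
  rw [← hX.integral_stoppedAt_zero (f := f) g]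
  refine ge_of_tendsto' (hX.tendsto_integral_stoppedAt hε h1 hx g) fun t => ?_
  induction t with
  | zero => exact le_rfl
  | succ t ih =>
    refine ih.trans ?_
    rw [hX.integral_stoppedAt_succ hε h1 hx g t, le_add_iff_nonneg_right]
    refine setIntegral_nonneg_ae (ℱ.le t _ (hX.measurableSet_alive t)) ?_
    filter_upwards [hg t] with ω h hω
    exact sub_nonneg.2 (h hω)

lemma jumpMean_neg (g : (Fin n → ℝ) → ℝ) (s : Fin n → ℝ) (i : Fin n) :
    jumpMean ε (fun s => -g s) s i = -jumpMean ε g s i := by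
  simp only [jumpMean]; ring

/-- Optional stopping for supermartingales. -/
lemma integral_finalPos_le [IsProbabilityMeasure μ] (hX : IsJumpProcess μ ℱ ε x X d)
    (hε : 0 < ε) (h1 : ε ≤ 1) (hx : x ∈ cube n) {g : (Fin n → ℝ) → ℝ}
    (hg : ∀ t, ∀ᵐ ω ∂μ, ω ∈ alive f X t → jumpMean ε g (X t ω) (d t ω) ≤ g (X t ω)) :
    ∫ ω, g (finalPos f X ω) ∂μ ≤ g x := by
  have := hX.le_integral_finalPos (f := f) hε h1 hx (g := fun s => -g s) fun t => by
    filter_upwards [hg t] with ω h hω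
    rw [jumpMean_neg]
    exact neg_le_neg (h hω)
  rw [integral_neg] at this
  linarith

/-- Each coordinate is preserved by jump means, hence is both a submartingale and a supermartingale.
-/
lemma integral_finalPos_eval [IsProbabilityMeasure μ] (hX : IsJumpProcess μ ℱ ε x X d)
    (hε : 0 < ε) (h1 : ε ≤ 1) (hx : x ∈ cube n) (i : Fin n) :
    ∫ ω, finalPos f X ω i ∂μ = x i :=
  le_antisymm
    (hX.integral_finalPos_le hε h1 hx (g := fun s => s i)
      fun _ => Eventually.of_forall fun _ _ => (jumpMean_eval hε _ _ _).le)
    (hX.le_integral_finalPos hε h1 hx (g := fun s => s i)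
      fun _ => Eventually.of_forall fun _ _ => (jumpMean_eval hε _ _ _).ge)

/-- Coordinate `i` has mean `x i` at the stopping time, so its variance is its second moment minus
`x i ^ 2`. -/
lemma cost_eq [IsProbabilityMeasure μ] (hX : IsJumpProcess μ ℱ ε x X d)
    (hε : 0 < ε) (h1 : ε ≤ 1) (hx : x ∈ cube n) :
    cost f μ X = ∫ ω, sqSum (finalPos f X ω) ∂μ - sqSum x := by
  have hvar : ∀ i, Var[fun ω => stoppedValue X (stopTime f X) ω i; μ] =
      ∫ ω, finalPos f X ω i ^ 2 ∂μ - x i ^ 2 := fun i => by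
    have hi := hX.integrable_finalPos (f := f) hε h1 hx (fun s => s i)
    have hm : MemLp (fun ω => finalPos f X ω i) 2 μ :=
      (memLp_two_iff_integrable_sq hi.aestronglyMeasurable).2
        (hX.integrable_finalPos hε h1 hx (fun s => s i ^ 2))
    have := variance_eq_sub hm
    rw [hX.integral_finalPos_eval hε h1 hx i] at this
    exact this
  rw [cost, Finset.sum_congr rfl fun i _ => hvar i, Finset.sum_sub_distrib,
    ← integral_finsetSum _ fun i _ => hX.integrable_finalPos hε h1 hx (fun s => s i ^ 2)]
  rfl

/-- No jump process costs less than the jump envelope predicts. -/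
lemma envelope_sub_le_cost [IsProbabilityMeasure μ] (hX : IsJumpProcess μ ℱ ε x X d)
    (hε : 0 < ε) (h1 : ε ≤ 1) (hx : x ∈ cube n) :
    envelope (jumpChord ε) f x - sqSum x ≤ cost f μ X := by
  rw [hX.cost_eq hε h1 hx]
  have h𝒞 := isChordSystem_jumpChord (n := n) hε h1
  have h2 := hX.le_integral_finalPos (f := f) hε h1 hx (g := envelope (jumpChord ε) f)
    fun t => by
      filter_upwards [hX.ae_mem_gridBox hε h1 hx, hX.ae_alive t] with ω h h3 hω
      exact (belowChord_iff_le_jumpMean hε _ _ _).1 ((isMinorant_envelope h𝒞).1 _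
        (gridBox_subset_cube (h t)) _ _ _ ⟨(h3 hω).2, rfl, rfl⟩)
  have h3 : ∫ ω, envelope (jumpChord ε) f (finalPos f X ω) ∂μ =
      ∫ ω, sqSum (finalPos f X ω) ∂μ := by
    refine integral_congr_ae ?_
    filter_upwards [hX.ae_finalPos_mem (f := f) hε h1 hx] with ω h
    exact envelope_eq_of_mem_solved h𝒞 (gridBox_subset_cube h.1) h.2
  linarith

/-- A process which never loses against the jump envelope attains the predicted cost. -/
lemma cost_le_envelope_sub [IsProbabilityMeasure μ] (hX : IsJumpProcess μ ℱ ε x X d)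
    (hε : 0 < ε) (h1 : ε ≤ 1) (hx : x ∈ cube n)
    (hd : ∀ t, ∀ᵐ ω ∂μ, ω ∈ alive f X t →
      jumpMean ε (envelope (jumpChord ε) f) (X t ω) (d t ω) ≤
        envelope (jumpChord ε) f (X t ω)) :
    cost f μ X ≤ envelope (jumpChord ε) f x - sqSum x := by
  rw [hX.cost_eq hε h1 hx]
  have h2 := hX.integral_finalPos_le (f := f) hε h1 hx hd
  have h3 : ∫ ω, sqSum (finalPos f X ω) ∂μ ≤
      ∫ ω, envelope (jumpChord ε) f (finalPos f X ω) ∂μ := by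
    refine integral_mono_ae (hX.integrable_finalPos hε h1 hx sqSum)
      (hX.integrable_finalPos hε h1 hx _) ?_
    filter_upwards [hX.ae_finalPos_mem (f := f) hε h1 hx] with ω h
    exact sqSum_le_envelope (isChordSystem_jumpChord hε h1) (gridBox_subset_cube h.1)
  linarith

end IsJumpProcess

end

end AxisAligned

/-! ### An optimal walk and the formula for the best cost. -/

namespace AxisAligned

noncomputable section

variable {n : ℕ} {ε : ℝ} {f : (Fin n → ℤˣ) → ℤˣ}

/-! ### An optimal direction -/

lemma jumpMean_mono (hε : 0 < ε) {g g' : (Fin n → ℝ) → ℝ} (h : ∀ s, g s ≤ g' s)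
    {s : Fin n → ℝ} {i : Fin n} (hi : s i ∈ Set.Ioo (-1 : ℝ) 1) :
    jumpMean ε g s i ≤ jumpMean ε g' s i := by
  have hp := upProb_mem_Icc hε hi
  have e1 := mul_le_mul_of_nonneg_left (h (jumpUp ε s i)) hp.1
  have e2 := mul_le_mul_of_nonneg_left (h (jumpDown ε s i)) (sub_nonneg.2 hp.2)
  unfold jumpMean
  linarith

/-- Away from the solved points, the jump envelope equals its mean after a jump in some
direction. -/
lemma exists_jumpMean_le (hε : 0 < ε) (h1 : ε ≤ 1) {x : Fin n → ℝ} (hx : x ∈ cube n)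
    (hf : x ∉ solved f) : ∃ i, x i ∈ Set.Ioo (-1 : ℝ) 1 ∧
      jumpMean ε (envelope (jumpChord ε) f) x i ≤ envelope (jumpChord ε) f x := by
  classical
  set W := envelope (jumpChord ε) f with hW
  have h𝒞 := isChordSystem_jumpChord (n := n) hε h1
  have hWm : IsMinorant (jumpChord ε) f W := isMinorant_envelope h𝒞
  by_contra! hcon
  -- If every jump mean at `x` exceeds `W x`, the envelope can be raised at the single point `x` up
  -- to the least of these means: other chord inequalities only gain, and `x` carries no constraint
  -- since it is unsolved.
  obtain ⟨v, hv, hvi⟩ : ∃ v > W x, ∀ i, x i ∈ Set.Ioo (-1 : ℝ) 1 → v ≤ jumpMean ε W x i := by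
    rcases {i | x i ∈ Set.Ioo (-1 : ℝ) 1}.eq_empty_or_nonempty with h | h
    · exact ⟨W x + 1, by linarith, fun i hi => absurd (h ▸ hi : i ∈ (∅ : Set (Fin n))) (by simp)⟩
    · obtain ⟨i, hi, hmin⟩ := Set.exists_min_image _ (jumpMean ε W x) (Set.toFinite _) h
      exact ⟨_, hcon i hi, hmin⟩
  set g : (Fin n → ℝ) → ℝ := Function.update W x v with hg
  have hgx : g x = v := by simp [hg]
  have hgne : ∀ y, y ≠ x → g y = W y := fun y hy => by simp [hg, hy]
  have hWg : ∀ y, W y ≤ g y := fun y => by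
    rcases eq_or_ne y x with rfl | hy
    · rw [hgx]; exact hv.le
    · rw [hgne y hy]
  have hgm : IsMinorant (jumpChord ε) f g := by
    refine ⟨?_, fun z hz hzf => ?_⟩
    · rintro y hy i _ _ ⟨hyi, rfl, rfl⟩
      rw [belowChord_iff_le_jumpMean hε]
      refine le_trans ?_ (jumpMean_mono hε hWg hyi)
      rcases eq_or_ne y x with rfl | hyx
      · rw [hgx]; exact hvi i hyi
      · rw [hgne y hyx, ← belowChord_iff_le_jumpMean hε]
        exact hWm.1 y hy i _ _ ⟨hyi, rfl, rfl⟩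
    · rw [hgne z (by rintro rfl; exact hf hzf)]
      exact hWm.2 z hz hzf
  have := hgm.le_envelope h𝒞 hx
  rw [hgx] at this
  exact absurd hv (not_lt.2 this)

/-- A measurable rule which chooses an optimal direction at every reachable position. -/
lemma exists_optimal_direction (hn : 0 < n) (hε : 0 < ε) (h1 : ε ≤ 1) (f : (Fin n → ℤˣ) → ℤˣ)
    (x : Fin n → ℝ) : ∃ δ : (Fin n → ℝ) → Fin n, Measurable δ ∧ ∀ s ∈ gridBox ε x,
      (s ∉ vertices n → s (δ s) ∈ Set.Ioo (-1 : ℝ) 1) ∧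
      (s ∉ solved f → jumpMean ε (envelope (jumpChord ε) f) s (δ s) ≤
        envelope (jumpChord ε) f s) := by
  classical
  have key : ∀ s : Fin n → ℝ, ∃ i, s ∈ gridBox ε x →
      (s ∉ vertices n → s i ∈ Set.Ioo (-1 : ℝ) 1) ∧
      (s ∉ solved f → jumpMean ε (envelope (jumpChord ε) f) s i ≤
        envelope (jumpChord ε) f s) := by
    intro s
    by_cases hs : s ∈ gridBox ε x
    · have hsc := gridBox_subset_cube hs
      by_cases hf : s ∈ solved f
      · by_cases hv : s ∈ vertices n
        · exact ⟨⟨0, hn⟩, fun _ => ⟨fun h => absurd hv h, fun h => absurd hf h⟩⟩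
        · have hv' : ∃ i, ¬(s i = -1 ∨ s i = 1) := by
            simpa only [mem_vertices, not_forall] using hv
          obtain ⟨i, hi⟩ := hv'
          rw [not_or] at hi
          exact ⟨i, fun _ => ⟨fun _ => mem_Ioo_of_ne (mem_cube.1 hsc i) hi.1 hi.2,
            fun h => absurd hf h⟩⟩
      · obtain ⟨i, hi, hle⟩ := exists_jumpMean_le hε h1 hsc hf
        exact ⟨i, fun _ => ⟨fun _ => hi, fun _ => hle⟩⟩
    · exact ⟨⟨0, hn⟩, fun h => absurd h hs⟩
  choose δ hδ using key
  -- The choice is arbitrary pointwise; making it constant off a finite set makes it measurable.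
  refine ⟨fun s => if s ∈ gridBox ε x then δ s else ⟨0, hn⟩, ?_, fun s hs => ?_⟩
  · refine (measurable_const (a := (⟨0, hn⟩ : Fin n))).measurable_of_countable_ne
      ((finite_gridBox hε x).countable.mono fun s hs => ?_)
    by_contra h
    exact hs (by rw [if_neg h])
  · simp only [if_pos hs]
    exact hδ s hs

/-! ### Conditional probabilities under an independent uniform variable -/

/-- Integrating out the independent uniform variable first, the event `U < p` has probability `p`.
-/
lemma condExp_lt_of_indep {Ω : Type} {m mΩ : MeasurableSpace Ω} (hm : m ≤ mΩ) {μ : Measure Ω}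
    [IsProbabilityMeasure μ] {U : Ω → unitInterval} (hU : Measurable U)
    (hlaw : μ.map U = volume) (hind : Indep m (MeasurableSpace.comap U inferInstance) μ)
    {p : Ω → unitInterval} (hp : Measurable[m] p) :
    μ⟦{ω | U ω < p ω} | m⟧ =ᵐ[μ] fun ω => (p ω : ℝ) := by
  have hpm : Measurable p := hp.mono hm le_rfl
  have hE : MeasurableSet {ω | U ω < p ω} := measurableSet_lt hU hpm
  have hpr : Measurable[m] fun ω => (p ω : ℝ) := measurable_subtype_coe.comp hp
  have hpi : Integrable (fun ω => (p ω : ℝ)) μ := Integrable.of_bound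
    (hpr.mono hm le_rfl).aestronglyMeasurable 1 (Eventually.of_forall fun ω => by
      rw [Real.norm_eq_abs, abs_of_nonneg (p ω).2.1]; exact (p ω).2.2)
  refine (ae_eq_condExp_of_forall_setIntegral_eq hm ((integrable_const 1).indicator hE)
    (fun _ _ _ => hpi.integrableOn) (fun A hA _ => ?_)
    hpr.stronglyMeasurable.aestronglyMeasurable).symm
  have hAm := hm A hA
  rw [setIntegral_indicator hE, setIntegral_const, smul_eq_mul, mul_one]
  -- Since `U < 0` is impossible, `A ∩ {U < p}` is simply `{U < Z}`, so only the joint law of `Z`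
  -- and `U` is needed.
  set Z : Ω → unitInterval := A.indicator p with hZ
  have hZm : Measurable[m] Z := hp.indicator hA
  have hZm' : Measurable Z := hZm.mono hm le_rfl
  have hZU : IndepFun Z U μ := by
    rw [IndepFun_iff_Indep]
    exact indep_of_indep_of_le_left hind hZm.comap_le
  have hset : A ∩ {ω | U ω < p ω} = (fun ω => (Z ω, U ω)) ⁻¹' {q | q.2 < q.1} := by
    ext ω
    by_cases hω : ω ∈ A
    · simp [hZ, hω]
    · simp [hZ, hω]
  have hmeas : MeasurableSet {q : unitInterval × unitInterval | q.2 < q.1} :=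
    measurableSet_lt measurable_snd measurable_fst
  have hmu : μ (A ∩ {ω | U ω < p ω}) = ∫⁻ ω, ENNReal.ofReal (Z ω) ∂μ := by
    rw [hset, ← Measure.map_apply (hZm'.prodMk hU) hmeas,
      (indepFun_iff_map_prod_eq_prod_map_map hZm'.aemeasurable hU.aemeasurable).1 hZU, hlaw,
      Measure.prod_apply hmeas, lintegral_map (measurable_measure_prodMk_left hmeas) hZm']
    refine lintegral_congr fun ω => ?_
    exact unitInterval.volume_Iio (Z ω)
  rw [measureReal_def, hmu, ← integral_eq_lintegral_of_nonneg_ae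
    (Eventually.of_forall fun ω => (Z ω).2.1)
    (measurable_subtype_coe.comp hZm').aestronglyMeasurable, ← integral_indicator hAm]
  refine integral_congr_ae (Eventually.of_forall fun ω => ?_)
  by_cases hω : ω ∈ A <;> simp [hZ, hω]

/-! ### The random walk which follows a rule -/

/-- The measure of independent uniform variables. -/
def coinMeasure : Measure (ℕ → unitInterval) := Measure.infinitePi fun _ => volume

instance : IsProbabilityMeasure coinMeasure := by
  unfold coinMeasure; infer_instance

lemma map_coinMeasure (t : ℕ) : coinMeasure.map (fun ω => ω t) = volume :=
  Measure.infinitePi_map_eval (fun _ : ℕ => (volume : Measure unitInterval)) t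

lemma indep_coin (t : ℕ) : Indep (Filtration.piLE (X := fun _ : ℕ => unitInterval) t)
    (MeasurableSpace.comap (fun ω : ℕ → unitInterval => ω (t + 1)) inferInstance)
    coinMeasure := by
  have h : iIndepFun (fun (i : ℕ) (ω : ℕ → unitInterval) => ω i) coinMeasure :=
    iIndepFun_infinitePi (X := fun _ : ℕ => (id : unitInterval → unitInterval))
      fun _ => measurable_id
  have h2 := h.indepFun_finset (Finset.Iic t) {t + 1} (by simp) fun i => measurable_pi_apply i
  rw [IndepFun_iff_Indep] at h2
  rw [Filtration.piLE_eq_comap_frestrictLe]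
  refine indep_of_indep_of_le_right h2 ?_
  rw [← measurable_iff_comap_le]
  have h3 : Measurable fun v : ({t + 1} : Finset ℕ) → unitInterval => v ⟨t + 1, by simp⟩ :=
    measurable_pi_apply _
  exact h3.comp (comap_measurable _)

open Classical in
/-- The walk from `x` which moves in the direction given by `δ`. -/
def walk (ε : ℝ) (δ : (Fin n → ℝ) → Fin n) (x : Fin n → ℝ) :
    ℕ → (ℕ → unitInterval) → Fin n → ℝ
  | 0, _ => x
  | t + 1, ω =>
    let s := walk ε δ x t ω
    if s ∈ vertices n then s
    -- The coin `t + 1` is independent of what is known at time `t`. The projection puts the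
    -- probability in `unitInterval`; it changes nothing when the chosen coordinate is interior.
    else if ω (t + 1) < Set.projIcc (0 : ℝ) 1 zero_le_one (upProb ε s (δ s)) then
      jumpUp ε s (δ s)
    else jumpDown ε s (δ s)

variable {δ : (Fin n → ℝ) → Fin n} {x : Fin n → ℝ}

lemma walk_mem_gridBox (hε : 0 < ε) (h1 : ε ≤ 1) (hx : x ∈ cube n)
    (hδ : ∀ s ∈ gridBox ε x, s ∉ vertices n → s (δ s) ∈ Set.Ioo (-1 : ℝ) 1) (t : ℕ)
    (ω : ℕ → unitInterval) : walk ε δ x t ω ∈ gridBox ε x := by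
  induction t with
  | zero => exact self_mem_gridBox hx
  | succ t ih =>
    simp only [walk]
    split_ifs with hv
    · exact ih
    · exact jumpUp_mem_gridBox hε h1 ih (hδ _ ih hv)
    · exact jumpDown_mem_gridBox hε h1 ih (hδ _ ih hv)

lemma measurable_piLE_apply (t : ℕ) :
    Measurable[Filtration.piLE (X := fun _ : ℕ => unitInterval) t]
      fun ω : ℕ → unitInterval => ω t := by
  rw [Filtration.piLE_eq_comap_frestrictLe]
  have h : Measurable fun v : Finset.Iic t → unitInterval => v ⟨t, by simp⟩ :=
    measurable_pi_apply _
  exact h.comp (comap_measurable _)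

lemma measurable_clip (hδ : Measurable δ) : Measurable fun s : Fin n → ℝ =>
    Set.projIcc (0 : ℝ) 1 zero_le_one (upProb ε s (δ s)) :=
  continuous_projIcc.measurable.comp ((measurable_upProb ε).comp (measurable_id.prodMk hδ))

lemma measurable_walk (hδ : Measurable δ) (t : ℕ) :
    Measurable[Filtration.piLE (X := fun _ : ℕ => unitInterval) t] (walk ε δ x t) := by
  induction t with
  | zero => exact measurable_const
  | succ t ih =>
    have ih' : Measurable[Filtration.piLE (X := fun _ : ℕ => unitInterval) (t + 1)]
        (walk ε δ x t) := ih.mono (Filtration.piLE.mono (Nat.le_succ t)) le_rfl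
    have hpair := measurable_id.prodMk hδ
    refine Measurable.ite (ih' measurableSet_vertices) ih' (Measurable.ite ?_ ?_ ?_)
    · exact @measurableSet_lt _ _ _ _ _ (_) _ _ _ _ _ (measurable_piLE_apply (t + 1))
        ((measurable_clip hδ).comp ih')
    · exact ((measurable_jumpUp ε).comp hpair).comp ih'
    · exact ((measurable_jumpDown ε).comp hpair).comp ih'

lemma isJumpProcess_walk (hε : 0 < ε) (h1 : ε ≤ 1) (hx : x ∈ cube n) (hδm : Measurable δ)
    (hδ : ∀ s ∈ gridBox ε x, s ∉ vertices n → s (δ s) ∈ Set.Ioo (-1 : ℝ) 1) :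
    IsJumpProcess coinMeasure (Filtration.piLE (X := fun _ : ℕ => unitInterval)) ε x
      (walk ε δ x) (fun t ω => δ (walk ε δ x t ω)) where
  adapted := measurable_walk hδm
  direction_adapted t := hδm.comp (measurable_walk hδm t)
  start := Eventually.of_forall fun _ => rfl
  stay t := Eventually.of_forall fun ω hv => by simp only [walk, if_pos hv]
  direction_mem t := Eventually.of_forall fun ω hv =>
    hδ _ (walk_mem_gridBox hε h1 hx hδ t ω) hv
  fixed t := Eventually.of_forall fun ω hv j hj => by
    simp only [walk, if_neg hv]
    split_ifs <;> simp [jumpUp, jumpDown, hj]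
  jump t := Eventually.of_forall fun ω hv => by
    simp only [walk, if_neg hv]
    split_ifs <;> simp [jumpUp, jumpDown]
  law t := by
    set A : Set (ℕ → unitInterval) := {ω | walk ε δ x t ω ∉ vertices n} with hA
    have hAm : MeasurableSet[Filtration.piLE (X := fun _ : ℕ => unitInterval) t] A :=
      (measurable_walk hδm t) measurableSet_vertices.compl
    have hle := (Filtration.piLE (X := fun _ : ℕ => unitInterval)).le t
    set p : (ℕ → unitInterval) → unitInterval := fun ω =>
      Set.projIcc (0 : ℝ) 1 zero_le_one (upProb ε (walk ε δ x t ω) (δ (walk ε δ x t ω))) with hp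
    have hpm : Measurable[Filtration.piLE (X := fun _ : ℕ => unitInterval) t] p :=
      (measurable_clip hδm).comp (measurable_walk hδm t)
    have hU : Measurable fun ω : ℕ → unitInterval => ω (t + 1) := measurable_pi_apply _
    have hcond := condExp_lt_of_indep hle hU (map_coinMeasure (t + 1))
      (indep_coin t) hpm
    have hwalk : ∀ s, Measurable (walk ε δ x s) := fun s =>
      (measurable_walk hδm s).mono (Filtration.piLE.le s) le_rfl
    set E : Set (ℕ → unitInterval) := {ω | walk ε δ x (t + 1) ω (δ (walk ε δ x t ω)) =
      upperEnd ε (walk ε δ x t ω (δ (walk ε δ x t ω)))} with hE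
    have hEm : MeasurableSet E := measurableSet_eq_fun
      (measurable_eval_fst.comp ((hwalk (t + 1)).prodMk (hδm.comp (hwalk t))))
      ((measurable_upperEnd ε).comp
        (measurable_eval_fst.comp ((hwalk t).prodMk (hδm.comp (hwalk t)))))
    have hE'm : MeasurableSet {ω : ℕ → unitInterval | ω (t + 1) < p ω} :=
      measurableSet_lt hU (hpm.mono hle le_rfl)
    -- Away from vertices the two ends are distinct, so landing on the upper end is the same as the
    -- coin event. Conditional expectations are compared only on `A`, which is known at time `t`.
    have hEA : A.indicator (E.indicator fun _ => (1 : ℝ)) =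
        A.indicator ({ω : ℕ → unitInterval | ω (t + 1) < p ω}.indicator fun _ => (1 : ℝ)) := by
      refine Set.indicator_congr fun ω hω => ?_
      have hi := hδ _ (walk_mem_gridBox hε h1 hx hδ t ω) hω
      have hlt := (lowerEnd_lt hε hi).trans (lt_upperEnd hε hi)
      have hiff : ω ∈ E ↔ ω (t + 1) < p ω := by
        simp only [hE, Set.mem_ofPred_eq, walk, if_neg (show walk ε δ x t ω ∉ vertices n from hω),
          hp]
        split_ifs with h
        · simp [jumpUp, h]
        · simp [jumpDown, h, hlt.ne]
      simp only [Set.indicator_apply, Set.mem_ofPred_eq, hiff]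
    have e1 := condExp_indicator (m := Filtration.piLE (X := fun _ : ℕ => unitInterval) t)
      (μ := coinMeasure) ((integrable_const (1 : ℝ)).indicator hEm) hAm
    have e2 := condExp_indicator (m := Filtration.piLE (X := fun _ : ℕ => unitInterval) t)
      (μ := coinMeasure) ((integrable_const (1 : ℝ)).indicator hE'm) hAm
    rw [hEA] at e1
    filter_upwards [e1, e2, hcond] with ω h2 h3 h4 hω
    rw [h2, Set.indicator_of_mem (show ω ∈ A from hω),
      Set.indicator_of_mem (show ω ∈ A from hω)] at h3
    rw [h3, h4]
    have hi := hδ _ (walk_mem_gridBox hε h1 hx hδ t ω) hω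
    simp only [hp, Set.projIcc_of_mem zero_le_one (upProb_mem_Icc hε hi)]
    rfl

/-- The best cost is given by the jump envelope. -/
lemma bestCost_eq (hn : 0 < n) (hε : 0 < ε) (h1 : ε ≤ 1) (f : (Fin n → ℤˣ) → ℤˣ)
    (hx : x ∈ cube n) : bestCost f ε x = envelope (jumpChord ε) f x - sqSum x := by
  have hlow : ∀ c ∈ costSet f ε x, envelope (jumpChord ε) f x - sqSum x ≤ c := by
    rintro c ⟨Ω, mΩ, μ, hμ, ℱ, X, d, hX, rfl⟩
    exact hX.envelope_sub_le_cost hε h1 hx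
  obtain ⟨δ, hδm, hδ⟩ := exists_optimal_direction hn hε h1 f x
  have hX := isJumpProcess_walk hε h1 hx hδm fun s hs => (hδ s hs).1
  have hmem : cost f coinMeasure (walk ε δ x) ∈ costSet f ε x :=
    ⟨_, _, coinMeasure, inferInstance, _, _, _, hX, rfl⟩
  refine le_antisymm ?_ (le_csInf ⟨_, hmem⟩ hlow)
  refine (csInf_le ⟨_, hlow⟩ hmem).trans (hX.cost_le_envelope_sub hε h1 hx fun t => ?_)
  exact Eventually.of_forall fun ω hω =>
    (hδ _ (walk_mem_gridBox hε h1 hx (fun s hs => (hδ s hs).1) t ω)).2 (notMem_solved_of_alive hω)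

lemma tendsto_bestCost (hn : 0 < n) (f : (Fin n → ℤˣ) → ℤˣ) (hx : x ∈ cube n) :
    Tendsto (fun k : ℕ => bestCost f ((1 / 2 : ℝ) ^ k) x) atTop
      (𝓝 (envelope fullChord f x - sqSum x)) := by
  simp only [bestCost_eq hn (halfPow_pos _) (halfPow_le_one _) f hx]
  exact (tendsto_envelope_jump hx).sub_const _

lemma limitCost_eq (hn : 0 < n) (f : (Fin n → ℤˣ) → ℤˣ) (hx : x ∈ cube n) :
    limitCost f x = envelope fullChord f x - sqSum x := (tendsto_bestCost hn f hx).limUnder_eq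

end

end AxisAligned

theorem mainTheorem6 (n : ℕ) (hn : 0 < n) (f : (Fin n → ℤˣ) → ℤˣ) :
    (∀ x ∈ AxisAligned.cube n,
      Tendsto (fun k : ℕ => AxisAligned.bestCost f ((1 / 2 : ℝ) ^ k) x) atTop
        (𝓝 (AxisAligned.limitCost f x))) ∧
    ContinuousOn (AxisAligned.limitCost f) (AxisAligned.cube n) ∧
    ((∀ x ∈ AxisAligned.cube n, AxisAligned.limitCost f x = 0) ∨
      AxisAligned.IsViscositySolution (AxisAligned.openCube n) (AxisAligned.limitCost f)
        (fun _ => -2)) := by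
  have hu := fun x (hx : x ∈ AxisAligned.cube n) => AxisAligned.limitCost_eq hn f hx
  refine ⟨fun x hx => ?_, ?_, ?_⟩
  · rw [hu x hx]
    exact AxisAligned.tendsto_bestCost hn f hx
  · exact (AxisAligned.continuousOn_envelope.sub
      AxisAligned.continuous_sqSum.continuousOn).congr hu
  -- An interior solved point makes all of the cube solved, where the envelope is `sqSum`; without
  -- one, the perturbation argument applies at every interior point.
  · by_cases h : ∃ z ∈ AxisAligned.openCube n, z ∈ AxisAligned.solved f
    · obtain ⟨z, hz, hzf⟩ := h
      refine Or.inl fun x hx => ?_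
      rw [hu x hx, AxisAligned.envelope_eq_of_mem_solved AxisAligned.isChordSystem_fullChord hx
        (AxisAligned.cube_subset_solved hz hzf hx), sub_self]
    · push Not at h
      exact Or.inr ⟨AxisAligned.isViscositySubsolution_of_eq hn hu,
        AxisAligned.isViscositySupersolution_of_eq h hu⟩
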